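/- Consider a $K$-armed bandit in which the rewards of arm $i$ are i.i.d. uniform on $[\mu_i-\sigma_i/2,\ \mu_i+\sigma_i/2]$ with unknown $\mu_i\in\mathbb R$, $\sigma_i>0$, and in which arm $1$ is the unique optimal arm: $\mu_1>\mu_i$ for $i\neq 1$. Put $\Delta_i=\mu_1-\mu_i$, $\Delta_{\max}=\max_{i\ne1}\Delta_i$ and $\mathrm{Reg}(T)=\sum_{t=1}^T\Delta_{j(t)}$, where $j(t)$ is the arm played in round $t$. Fix $k\in\mathbb R$. Thompson sampling with truncation (TS-T) with the prior $\sigma^{-k}$ first plays every arm $n_0=\max(2,3-\lceil k\rceil)$ times. In each later round it draws independently for the arms $i$, given the past, a pair $(\tilde\sigma_i,\tilde\mu_i)$, and plays an arm with the largest $\tilde\mu_i$. If arm $i$ has been played $n$ times, with smallest reward $x_{(1)}$ and largest reward $x_{(n)}$, put $\bar x_{(n)}=\max(x_{(1)}+\tfrac1n,\,x_{(n)})$, $\bar\sigma=\bar x_{(n)}-x_{(1)}$ and $m=n+k-2$; then $\tilde\sigma_i$ has the density $m(m+1)\bar\sigma^{m}(s-\bar\sigma)s^{-m-2}\mathbf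 1[s\ge\bar\sigma]$, and given $\tilde\sigma_i=s$, $\tilde\mu_i$ is uniform on $[\bar x_{(n)}-s/2,\ x_{(1)}+s/2]$ (the posterior under the prior $\sigma^{-k}$, with the maximum $x_{(n)}$ replaced by $\bar x_{(n)}$). There is a function $C'(\epsilon,k,\sigma_1)$ of $\epsilon,\sigma_1>0$ and $k\in\mathbb{R}$ such that for every such bandit, every $k\in\mathbb R$, every $\epsilon\in(0,\min_{i\ne1}\Delta_i/2)$ and every $T$, TS-T with the prior $\sigma^{-k}$ satisfies $$\mathbb E[\mathrm{Reg}(T)]\le\sum_{i=2}^K\Delta_i\left(\frac{\log T}{\log\left(1+\frac{2\Delta_i-4\epsilon}{\sigma_i}\right)}+\frac{2\sigma_i}{\epsilon}+\frac1{\sigma_i}+\max\left(\tfrac72,\tfrac92-\lceil k\rceil\right)\right)+\Delta_{\max}\,C'(\epsilon,k,\sigma_1),$$ and such that, with constants that may depend on $k$ and on $\epsilon_0,\sigma_0$ (and $\epsilon_1$), but not on the bandit: * for $k<1$, $C'(\epsilon,k,\sigma_1)=1+\frac{9\sigma_1}{\epsilon}+\frac{3}{16}\max\left(1,\frac1{1-k}\right)\frac{\sigma_1^2}{\epsilon^2}\left(2e^{2\epsilon/\sigma_1}-1\right)$,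 which is $O(\sigma_1^2/\epsilon^2)$ uniformly over $0<\epsilon\le\epsilon_0$, $\sigma_1\ge\sigma_0$, for all $\epsilon_0,\sigma_0>0$; * for $k=1$, $C'(\epsilon,1,\sigma_1)=O(\sigma_1^2\log(\sigma_1)/\epsilon^2)$ uniformly over $\epsilon_1\le\epsilon\le\epsilon_0$, $\sigma_1\ge\sigma_0$, for all $\epsilon_1,\epsilon_0>0$ and $\sigma_0>1$; and, including $\epsilon\to0$, $C'(\epsilon,1,\sigma_1)=O(\sigma_1^2\log(1+\sigma_1/\epsilon)/\epsilon^2)$ uniformly over $0<\epsilon\le\epsilon_0$, $\sigma_1\ge\sigma_0$, for all $\epsilon_0,\sigma_0>0$; * for $k>1$, $C'(\epsilon,k,\sigma_1)=O(\sigma_1^{2k}/\epsilon^{k+1})$ uniformly over $0<\epsilon\le\epsilon_0$, $\sigma_1\ge\sigma_0$, for all $\epsilon_0,\sigma_0>0$. Moreover, for every $k\in\mathbb R$, in particular for the reference prior $k=1$ and the Jeffreys prior $k=2$, TS-T is asymptotically optimal: $$\limsup_{T\to\infty}\frac{\mathbb E[\mathrm{Reg}(T)]}{\log T}\le\sum_{i=2}^K\frac{\Delta_i}{\inf\{\mathrm{KL}(\nu_i;\nu)\,:\,\nu\text{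 a uniform distribution with mean}>\mu_1\}},$$ where $\nu_i$ is the reward distribution of arm $i$ and $\mathrm{KL}$ is the Kullback-Leibler divergence. -/

import Mathlib

open MeasureTheory ProbabilityTheory Filter Asymptotics

namespace UniformBandit

/-- Density of the uniform distribution with mean `m` and scale (length of the support) `s`. -/
noncomputable def uniDensity (m s x : ℝ) : ℝ :=
  if m - s / 2 ≤ x ∧ x ≤ m + s / 2 then 1 / s else 0

/-- The uniform distribution with mean `m` and scale `s`. -/
noncomputable def uniLaw (m s : ℝ) : Measure ℝ :=
  volume.withDensity fun x => ENNReal.ofReal (uniDensity m s x)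

/-- Smallest of the first `n` observations `x 0, …, x (n - 1)`. -/
noncomputable def minStat (x : ℕ → ℝ) (n : ℕ) : ℝ := ⨅ s : Fin n, x s

/-- Largest of the first `n` observations `x 0, …, x (n - 1)`. -/
noncomputable def maxStat (x : ℕ → ℝ) (n : ℕ) : ℝ := ⨆ s : Fin n, x s

/-- The truncated maximum `max (x₍₁₎ + 1/n, x₍ₙ₎)`. -/
noncomputable def truncMax (x : ℕ → ℝ) (n : ℕ) : ℝ :=
  max (minStat x n + 1 / (n : ℝ)) (maxStat x n)

/-- Marginal posterior density of the scale, at `s`, when the scale estimate is `σh`;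
here `m = n + k - 2` for `n` observations and the prior `σ ^ (-k)`. -/
noncomputable def scaleDensity (m σh s : ℝ) : ℝ :=
  if σh ≤ s then m * (m + 1) * σh ^ m * (s - σh) / s ^ (m + 2) else 0

/-- Joint posterior density of (scale, mean) given the estimates `μh`, `σh`: the scale `s` has the
marginal density above and, given `s`, the mean is uniform with mean `μh` and scale `s - σh`.
For `μh = (a + b) / 2`, `σh = b - a` this is proportional to
`s ^ (-k) * s ^ (-n)` on the region `mean - s / 2 ≤ a`, `b ≤ mean + s / 2`,
i.e. prior times likelihood of `n` observations with minimum `a` and maximum `b`. -/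
noncomputable def posteriorDensity (m μh σh : ℝ) (p : ℝ × ℝ) : ℝ :=
  scaleDensity m σh p.1 * uniDensity μh (p.1 - σh) p.2

/-- The law of the pair (scale, mean) sampled by TS-T for an arm, under the prior `σ ^ (-k)`, when
its first `n` rewards are `x 0, …, x (n - 1)`: the posterior with the maximum of the observations
replaced by the truncated maximum. -/
noncomputable def tstLaw (k : ℝ) (n : ℕ) (x : ℕ → ℝ) : Measure (ℝ × ℝ) :=
  volume.withDensity fun p => ENNReal.ofReal
    (posteriorDensity ((n : ℝ) + k - 2) ((minStat x n + truncMax x n) / 2)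
      (truncMax x n - minStat x n) p)

/-- The number `max (2, 3 - ⌈k⌉)` of initial plays of every arm. -/
noncomputable def n0 (k : ℝ) : ℕ := (max 2 (3 - ⌈k⌉)).toNat

variable {Ω : Type*} {K : ℕ}

/-- Number of plays of arm `i` in the rounds `0, …, t - 1`. -/
def pulls (arm : ℕ → Ω → Fin K) (i : Fin K) (t : ℕ) (ω : Ω) : ℕ :=
  ∑ s ∈ Finset.range t, if arm s ω = i then 1 else 0

/-- The sigma-algebra generated by the whole table of rewards and by the samples and the played
arms of the rounds before `t`. -/
def past (X : Fin K → ℕ → Ω → ℝ) (θ : ℕ → Fin K → Ω → ℝ × ℝ) (arm : ℕ → Ω → Fin K) (t : ℕ) :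
    MeasurableSpace Ω :=
  (⨆ (i : Fin K) (s : ℕ), MeasurableSpace.comap (X i s) inferInstance) ⊔
    (⨆ (s : ℕ) (_ : s < t), (⨆ i : Fin K, MeasurableSpace.comap (θ s i) inferInstance) ⊔
      MeasurableSpace.comap (arm s) inferInstance)

/-- A run of TS-T with the prior `σ ^ (-k)` in the uniform bandit with means `μ` and scales `σ`.
`X i s` is the reward of the play number `s + 1` of arm `i`, `θ t i` the pair (scale, mean) sampled
for arm `i` in round `t`, and `arm t` the arm played in round `t` (rounds start at `0`). -/
structure IsTSTRun [MeasurableSpace Ω] (P : Measure Ω) (μ σ : Fin K → ℝ) (k : ℝ)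
    (X : Fin K → ℕ → Ω → ℝ) (θ : ℕ → Fin K → Ω → ℝ × ℝ) (arm : ℕ → Ω → Fin K) : Prop where
  measurable_reward : ∀ i s, Measurable (X i s)
  measurable_sample : ∀ t i, Measurable (θ t i)
  measurable_arm : ∀ t, Measurable (arm t)
  /-- the rewards are independent, those of arm `i` having the uniform law of that arm -/
  reward_law : ∀ i s, P.map (X i s) = uniLaw (μ i) (σ i)
  reward_indep : iIndepFun (fun p : Fin K × ℕ => X p.1 p.2) P
  /-- in the first `K * n0 k` rounds every arm is played `n0 k` times -/
  initial : ∀ ω i, pulls arm i (K * n0 k) ω = n0 k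
  /-- afterwards, conditionally on the past, the samples of the arms are independent, and that of
  arm `i` follows `tstLaw` for the rewards observed from arm `i` so far -/
  sample_law : ∀ t, K * n0 k ≤ t → ∀ E : Set Ω, MeasurableSet[past X θ arm t] E →
    ∀ B : Fin K → Set (ℝ × ℝ), (∀ i, MeasurableSet (B i)) →
      P (E ∩ {ω | ∀ i, θ t i ω ∈ B i}) =
        ∫⁻ ω in E, ∏ i, tstLaw k (pulls arm i t ω) (fun s => X i s ω) (B i) ∂P
  /-- and an arm with the largest sampled mean is played -/
  argmax : ∀ t, K * n0 k ≤ t → ∀ ω i, (θ t i ω).2 ≤ (θ t (arm t ω) ω).2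

/-- The regret of the first `T` rounds, when `opt` is the optimal arm. -/
def regret (μ : Fin K → ℝ) (opt : Fin K) (arm : ℕ → Ω → Fin K) (T : ℕ) (ω : Ω) : ℝ :=
  ∑ t ∈ Finset.range T, (μ opt - μ (arm t ω))

/-- Infimum of the Kullback-Leibler divergences from the uniform law with mean `m` and scale `s`
to the uniform laws with a mean greater than `m₁`. -/
noncomputable def klInf (m s m₁ : ℝ) : ENNReal :=
  ⨅ (m' : ℝ) (s' : ℝ) (_ : 0 < s') (_ : m₁ < m'),
    InformationTheory.klDiv (uniLaw m s) (uniLaw m' s')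

/-- Asymptotic optimality: the expected regret attains the lower bound for consistent policies,
`limsup E[Reg(T)] / log T ≤ ∑ Δᵢ / inf KL`. -/
def AsymptoticallyOptimal [MeasurableSpace Ω] (P : Measure Ω) (μ σ : Fin K → ℝ) (opt : Fin K)
    (arm : ℕ → Ω → Fin K) : Prop :=
  limsup (fun T : ℕ => (((∫ ω, regret μ opt arm T ω ∂P) / Real.log T : ℝ) : EReal)) atTop ≤
    ((∑ i ∈ Finset.univ.erase opt, (μ opt - μ i) / (klInf (μ i) (σ i) (μ opt)).toReal : ℝ) : EReal)

end UniformBandit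

/-! Fix the threshold `y = μ opt - 3 * ε / 2`. A suboptimal play of arm `i` happens in the initial
phase, or with a sampled mean of `i` that is at least `y`, or in a later round in which all sampled
means are below `y`, because the played arm has the largest sample. The first two kinds are charged
to arm `i`, the third to the optimal arm.

Both counts rest on an explicit posterior tail (`posterior_tail`): at distance `d` from the midpoint
of the estimates, each tail of the sampled mean has mass exactly `1/2 * (σh / (σh + 2 * d)) ^ m`.
For a suboptimal arm, once the observed minimum is within `ε / 2` of the left endpoint and about
`log T / log (1 + (2 * Δ - 4 * ε) / σ)` plays have been made, the tail above `y` is at most `1 / (2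
* T)`. This gives the logarithmic term; the other plays cost a bounded number in expectation
(`IsTSTRun.sum_measure_suboptimal_le`).

For the third kind, conditional independence of the samples allows a change of measure: the
probability that the optimal sample is below `y` is its odds times the probability that it is at
least `y`, and if it is at least `y` while all others are below, the optimal arm is played. Each
play of that arm uses a new sample size, so the sum over rounds is at most the sum over `n` of the
expected odds at sample size `n` (`IsTSTRun.sum_measure_all_lt_le`), which no longer involves the
policy.

The expected odds are summed in `sum_lintegral_odds_le`. The dangerous case is a midpoint of the
estimates below `y`: the odds are then at most twice a power `n + k - 2` of `2 * (y - minimum)` over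
the truncated range. Against the joint law of minimum and maximum this leads to the integral of `max
(1/n) s ^ (-k)` in the range `s`. It converges at `0` without truncation exactly for `k < 1`; for `k
= 1` the truncation at `1/n` costs a logarithm, for `k > 1` a factor of order `n ^ (k - 1)`. These
are the three regimes of the constant.

For asymptotic optimality, the infimum of the divergences is `log (1 + 2 * Δ / σ)` (`klInf_eq`), the
limit as `ε → 0` of the denominators in the finite-time bound: divide by `log T`, let `T → ∞` with
`ε` fixed, then `ε → 0`. -/

namespace UniformBandit

open Set
open scoped ENNReal Topology

/-! ### Uniform laws and their Kullback-Leibler divergences. -/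

section UniformLaw

lemma uniLaw_eq (m s : ℝ) :
    uniLaw m s = ENNReal.ofReal (1 / s) • volume.restrict (Icc (m - s / 2) (m + s / 2)) := by
  have h : (fun x => ENNReal.ofReal (uniDensity m s x)) =
      (Icc (m - s / 2) (m + s / 2)).indicator (fun _ => ENNReal.ofReal (1 / s)) := by
    ext x
    by_cases hx : x ∈ Icc (m - s / 2) (m + s / 2)
    · rw [indicator_of_mem hx, uniDensity, if_pos (mem_Icc.1 hx)]
    · rw [indicator_of_notMem hx, uniDensity, if_neg (fun h => hx (mem_Icc.2 h)), ENNReal.ofReal_zero]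
  rw [uniLaw, h, withDensity_indicator measurableSet_Icc, withDensity_const]

lemma uniLaw_apply (m s : ℝ) {S : Set ℝ} (hS : MeasurableSet S) :
    uniLaw m s S = ENNReal.ofReal (1 / s) * volume (S ∩ Icc (m - s / 2) (m + s / 2)) := by
  rw [uniLaw_eq, Measure.smul_apply, Measure.restrict_apply hS, smul_eq_mul]

lemma uniLaw_univ (m : ℝ) {s : ℝ} (hs : 0 < s) : uniLaw m s univ = 1 := by
  rw [uniLaw_apply m s MeasurableSet.univ, univ_inter, Real.volume_Icc,
    ← ENNReal.ofReal_mul (by positivity)]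
  rw [show 1 / s * (m + s / 2 - (m - s / 2)) = 1 by field_simp; ring]
  simp

lemma isProbabilityMeasure_uniLaw (m : ℝ) {s : ℝ} (hs : 0 < s) :
    IsProbabilityMeasure (uniLaw m s) := ⟨uniLaw_univ m hs⟩

lemma lintegral_uniLaw (m s : ℝ) (f : ℝ → ℝ≥0∞) :
    ∫⁻ x, f x ∂uniLaw m s =
      ENNReal.ofReal (1 / s) * ∫⁻ x in Icc (m - s / 2) (m + s / 2), f x := by
  rw [uniLaw_eq, lintegral_smul_measure, smul_eq_mul]

lemma uniLaw_compl_Icc (m s : ℝ) : uniLaw m s (Icc (m - s / 2) (m + s / 2))ᶜ = 0 := by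
  rw [uniLaw_apply m s measurableSet_Icc.compl]
  simp

lemma uniLaw_eq_withDensity {m s m' s' : ℝ} (hs : 0 < s) (hs' : 0 < s')
    (hl : m' - s' / 2 ≤ m - s / 2) (hr : m + s / 2 ≤ m' + s' / 2) :
    uniLaw m s = (uniLaw m' s').withDensity
      ((Icc (m - s / 2) (m + s / 2)).indicator fun _ => ENNReal.ofReal (s' / s)) := by
  rw [withDensity_indicator measurableSet_Icc, withDensity_const, uniLaw_eq, uniLaw_eq,
    Measure.restrict_smul, Measure.restrict_restrict measurableSet_Icc,
    inter_eq_left.2 (Icc_subset_Icc hl hr), smul_smul, ← ENNReal.ofReal_mul (by positivity)]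
  congr 2
  field_simp

/-- If an endpoint stuck out, an open interval next to it would carry mass under the first law only.
-/
lemma support_subset_of_absolutelyContinuous {m s m' s' : ℝ} (hs : 0 < s)
    (h : uniLaw m s ≪ uniLaw m' s') : m' - s' / 2 ≤ m - s / 2 ∧ m + s / 2 ≤ m' + s' / 2 := by
  have h0 := h (uniLaw_compl_Icc m' s')
  rw [uniLaw_apply m s measurableSet_Icc.compl, mul_eq_zero] at h0
  have h1 : volume ((Icc (m' - s' / 2) (m' + s' / 2))ᶜ ∩ Icc (m - s / 2) (m + s / 2)) = 0 := by
    refine h0.resolve_left ?_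
    simpa using hs
  constructor
  · by_contra! hlt
    have hsub : Ioo (m - s / 2) (min (m' - s' / 2) (m + s / 2)) ⊆
        (Icc (m' - s' / 2) (m' + s' / 2))ᶜ ∩ Icc (m - s / 2) (m + s / 2) := by
      intro x hx
      rw [mem_Ioo, lt_min_iff] at hx
      exact ⟨fun h => by linarith [h.1], ⟨by linarith, by linarith⟩⟩
    have h2 := measure_mono_null hsub h1
    rw [Real.volume_Ioo, ENNReal.ofReal_eq_zero] at h2
    have : m - s / 2 < min (m' - s' / 2) (m + s / 2) := lt_min hlt (by linarith)
    linarith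
  · by_contra! hlt
    have hsub : Ioo (max (m' + s' / 2) (m - s / 2)) (m + s / 2) ⊆
        (Icc (m' - s' / 2) (m' + s' / 2))ᶜ ∩ Icc (m - s / 2) (m + s / 2) := by
      intro x hx
      rw [mem_Ioo, max_lt_iff] at hx
      exact ⟨fun h => by linarith [h.2], ⟨by linarith, by linarith⟩⟩
    have h2 := measure_mono_null hsub h1
    rw [Real.volume_Ioo, ENNReal.ofReal_eq_zero] at h2
    have : max (m' + s' / 2) (m - s / 2) < m + s / 2 := max_lt hlt (by linarith)
    linarith

/-- On the smaller support the likelihood ratio is the constant `s' / s`, so its logarithm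
integrates to itself. -/
lemma klDiv_uniLaw {m s m' s' : ℝ} (hs : 0 < s) (hs' : 0 < s')
    (hl : m' - s' / 2 ≤ m - s / 2) (hr : m + s / 2 ≤ m' + s' / 2) :
    InformationTheory.klDiv (uniLaw m s) (uniLaw m' s') = ENNReal.ofReal (Real.log (s' / s)) := by
  have := isProbabilityMeasure_uniLaw m hs
  have := isProbabilityMeasure_uniLaw m' hs'
  have heq := uniLaw_eq_withDensity hs hs' hl hr
  have hac : uniLaw m s ≪ uniLaw m' s' := by
    rw [heq]; exact withDensity_absolutelyContinuous _ _
  have hrn : (uniLaw m s).rnDeriv (uniLaw m' s') =ᵐ[uniLaw m s]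
      (Icc (m - s / 2) (m + s / 2)).indicator fun _ => ENNReal.ofReal (s' / s) := by
    refine hac.ae_le ?_
    nth_rewrite 1 [heq]
    exact Measure.rnDeriv_withDensity _ (measurable_const.indicator measurableSet_Icc)
  have hmem : ∀ᵐ x ∂uniLaw m s, x ∈ Icc (m - s / 2) (m + s / 2) := uniLaw_compl_Icc m s
  have hllr : llr (uniLaw m s) (uniLaw m' s') =ᵐ[uniLaw m s] fun _ => Real.log (s' / s) := by
    filter_upwards [hrn, hmem] with x hx hx'
    rw [llr, hx, indicator_of_mem hx', ENNReal.toReal_ofReal (by positivity)]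
  rw [InformationTheory.klDiv_of_ac_of_integrable hac ((integrable_const _).congr hllr.symm),
    integral_congr_ae hllr]
  simp

/-- The divergence is finite only if the support is contained in the new one. The cheapest way to
move the mean up to `m'` is then to keep the left endpoint and stretch the right one, which needs
the length `s + 2 * (m' - m)`. As `m' > m₁` is strict, the value is reached only in the limit `m' ↓
m₁`. -/
lemma klInf_eq {m s m₁ : ℝ} (hs : 0 < s) (hm : m < m₁) :
    klInf m s m₁ = ENNReal.ofReal (Real.log (1 + 2 * (m₁ - m) / s)) := by
  apply le_antisymm
  · have hbound : ∀ᶠ m' in 𝓝[>] m₁,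
        klInf m s m₁ ≤ ENNReal.ofReal (Real.log (1 + 2 * (m' - m) / s)) := by
      filter_upwards [self_mem_nhdsWithin] with m' hm'
      have hm'' : m₁ < m' := hm'
      have hs' : 0 < 2 * (m' - m) + s := by linarith
      refine (iInf_le_of_le m' <| iInf_le_of_le (2 * (m' - m) + s) <| iInf_le_of_le hs' <|
        iInf_le_of_le hm' le_rfl).trans ?_
      rw [klDiv_uniLaw hs hs' (by linarith) (by linarith)]
      rw [show (2 * (m' - m) + s) / s = 1 + 2 * (m' - m) / s by field_simp; ring]
    refine ge_of_tendsto ?_ hbound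
    have hc : ContinuousAt (fun m' : ℝ => ENNReal.ofReal (Real.log (1 + 2 * (m' - m) / s))) m₁ := by
      have hpos : 0 < 2 * (m₁ - m) / s := div_pos (by linarith) hs
      refine ENNReal.continuous_ofReal.continuousAt.comp (ContinuousAt.log ?_ (by positivity))
      fun_prop
    exact hc.tendsto.mono_left nhdsWithin_le_nhds
  · refine le_iInf fun m' => le_iInf fun s' => le_iInf fun hs' => le_iInf fun hm' => ?_
    by_cases hac : uniLaw m s ≪ uniLaw m' s'
    · obtain ⟨hl, hr⟩ := support_subset_of_absolutelyContinuous hs hac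
      rw [klDiv_uniLaw hs hs' hl hr]
      have hpos : 0 < 2 * (m₁ - m) / s := div_pos (by linarith) hs
      refine ENNReal.ofReal_le_ofReal (Real.log_le_log (by positivity) ?_)
      rw [le_div_iff₀ hs, add_mul, div_mul_cancel₀ _ hs.ne']
      linarith
    · rw [InformationTheory.klDiv_of_not_ac hac]
      exact le_top

end UniformLaw

/-! ### Exact tails of the sampled mean. -/

section PosteriorTail

lemma uniLaw_Ici {m w d : ℝ} (hw : 0 < w) (hd : 0 ≤ d) :
    uniLaw m w (Ici (m + d)) = ENNReal.ofReal ((w / 2 - d) / w) := by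
  have h : Ici (m + d) ∩ Icc (m - w / 2) (m + w / 2) = Icc (m + d) (m + w / 2) := by
    ext x
    simp only [mem_inter_iff, mem_Ici, mem_Icc]
    constructor
    · rintro ⟨h1, -, h2⟩; exact ⟨h1, h2⟩
    · rintro ⟨h1, h2⟩; exact ⟨h1, by linarith, h2⟩
  rw [uniLaw_apply _ _ measurableSet_Ici, h, Real.volume_Icc, ← ENNReal.ofReal_mul (by positivity)]
  congr 1
  ring

lemma uniLaw_Iio {m w d : ℝ} (hw : 0 < w) (hd : 0 ≤ d) :
    uniLaw m w (Iio (m - d)) = ENNReal.ofReal ((w / 2 - d) / w) := by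
  have h : Iio (m - d) ∩ Icc (m - w / 2) (m + w / 2) = Ico (m - w / 2) (m - d) := by
    ext x
    simp only [mem_inter_iff, mem_Iio, mem_Icc, mem_Ico]
    constructor
    · rintro ⟨h1, h2, -⟩; exact ⟨h2, h1⟩
    · rintro ⟨h1, h2⟩; exact ⟨h2, h1, by linarith⟩
  rw [uniLaw_apply _ _ measurableSet_Iio, h, Real.volume_Ico, ← ENNReal.ofReal_mul (by positivity)]
  congr 1
  ring

/-- The law on pairs (scale, mean) with density `posteriorDensity`. -/
noncomputable def posterior (m μh σh : ℝ) : Measure (ℝ × ℝ) :=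
  volume.withDensity fun p => ENNReal.ofReal (posteriorDensity m μh σh p)

lemma measurable_scaleDensity (m σh : ℝ) : Measurable (scaleDensity m σh) := by
  unfold scaleDensity
  refine Measurable.ite measurableSet_Ici ?_ measurable_const
  fun_prop

lemma measurable_posteriorDensity (m μh σh : ℝ) : Measurable (posteriorDensity m μh σh) := by
  unfold posteriorDensity
  refine ((measurable_scaleDensity m σh).comp measurable_fst).mul ?_
  unfold uniDensity
  refine Measurable.ite ?_ (by fun_prop) measurable_const
  have h1 : Measurable fun p : ℝ × ℝ => μh - (p.1 - σh) / 2 := by fun_prop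
  have h2 : Measurable fun p : ℝ × ℝ => μh + (p.1 - σh) / 2 := by fun_prop
  exact (measurableSet_le h1 measurable_snd).inter (measurableSet_le measurable_snd h2)

lemma scaleDensity_nonneg {m σh : ℝ} (hm : 0 ≤ m) (hσ : 0 < σh) (s : ℝ) :
    0 ≤ scaleDensity m σh s := by
  unfold scaleDensity
  split_ifs with h
  · have : 0 < s := hσ.trans_le h
    have : 0 ≤ s - σh := sub_nonneg.2 h
    positivity
  · exact le_rfl

lemma posterior_apply {m μh σh : ℝ} (hm : 0 ≤ m) (hσ : 0 < σh) {S : Set ℝ}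
    (hS : MeasurableSet S) :
    posterior m μh σh {p | p.2 ∈ S} =
      ∫⁻ s, ENNReal.ofReal (scaleDensity m σh s) * uniLaw μh (s - σh) S := by
  have hset : {p : ℝ × ℝ | p.2 ∈ S} = univ ×ˢ S := by ext; simp
  have hmeas := (measurable_posteriorDensity m μh σh).ennreal_ofReal
  rw [posterior, hset, withDensity_apply _ (MeasurableSet.univ.prod hS), Measure.volume_eq_prod,
    ← Measure.prod_restrict, lintegral_prod _ hmeas.aemeasurable, Measure.restrict_univ]
  refine lintegral_congr fun s => ?_
  rw [uniLaw, withDensity_apply _ hS, ← lintegral_const_mul' _ _ ENNReal.ofReal_ne_top]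
  refine lintegral_congr fun x => ?_
  rw [posteriorDensity, ENNReal.ofReal_mul (scaleDensity_nonneg hm hσ s)]

lemma integral_sub_div_rpow {m L : ℝ} (hm : 0 < m) (hL : 0 < L) :
    IntegrableOn (fun s : ℝ => (s - L) / s ^ (m + 2)) (Ioi L) ∧
      ∫ s in Ioi L, (s - L) / s ^ (m + 2) = L ^ (-m) / (m * (m + 1)) := by
  have heq : EqOn (fun s : ℝ => s ^ (-(m + 1)) - L * s ^ (-(m + 2)))
      (fun s : ℝ => (s - L) / s ^ (m + 2)) (Ioi L) := by
    intro s hs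
    have hs0 : 0 < s := hL.trans hs
    simp only
    rw [show -(m + 1) = -(m + 2) + 1 by ring, Real.rpow_add_one hs0.ne', Real.rpow_neg hs0.le]
    field_simp
  have h1 : IntegrableOn (fun s : ℝ => s ^ (-(m + 1))) (Ioi L) :=
    integrableOn_Ioi_rpow_of_lt (by linarith) hL
  have h2 : IntegrableOn (fun s : ℝ => L * s ^ (-(m + 2))) (Ioi L) :=
    (integrableOn_Ioi_rpow_of_lt (by linarith) hL).const_mul _
  refine ⟨(h1.sub h2).congr_fun heq measurableSet_Ioi, ?_⟩
  rw [← setIntegral_congr_fun measurableSet_Ioi heq, integral_sub h1 h2, integral_const_mul,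
    integral_Ioi_rpow_of_lt (by linarith) hL, integral_Ioi_rpow_of_lt (by linarith) hL,
    show -(m + 2) + 1 = -m - 1 by ring, show -(m + 1) + 1 = -m by ring, Real.rpow_sub_one hL.ne']
  have h3 : -m - 1 ≠ 0 := by linarith
  have h4 : m + 1 ≠ 0 := by linarith
  rw [show -m - 1 = -(m + 1) by ring]
  field_simp
  ring

/-- Given the scale `s`, the tail `((s - σh) / 2 - d) / (s - σh)` cancels the factor `s - σh` of the
scale density. What remains has the shape of the same density with `σh + 2 * d` in place of `σh`, so
its integral is known. The set `S` stands for either of the two half-lines. -/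
lemma posterior_tail {m μh σh d : ℝ} (hm : 0 < m) (hσ : 0 < σh) (hd : 0 ≤ d) {S : Set ℝ}
    (hS : MeasurableSet S)
    (hunif : ∀ w, 0 < w → uniLaw μh w S = ENNReal.ofReal ((w / 2 - d) / w)) :
    posterior m μh σh {p | p.2 ∈ S} = ENNReal.ofReal (1 / 2 * (σh / (σh + 2 * d)) ^ m) := by
  have hL : 0 < σh + 2 * d := by positivity
  obtain ⟨hint, hval⟩ := integral_sub_div_rpow hm hL
  rw [posterior_apply hm.le hσ hS]
  have hpt : ∀ s, ENNReal.ofReal (scaleDensity m σh s) * uniLaw μh (s - σh) S =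
      (Ioi (σh + 2 * d)).indicator (fun s => ENNReal.ofReal
        (m * (m + 1) * σh ^ m / 2 * ((s - (σh + 2 * d)) / s ^ (m + 2)))) s := by
    intro s
    by_cases h : s ∈ Ioi (σh + 2 * d)
    · rw [indicator_of_mem h]
      have h' : σh + 2 * d < s := h
      have hs : 0 < s - σh := by linarith
      rw [hunif _ hs, ← ENNReal.ofReal_mul (scaleDensity_nonneg hm.le hσ s), scaleDensity,
        if_pos (by linarith)]
      congr 1
      field_simp
      ring
    · rw [indicator_of_notMem h]
      have h' : s ≤ σh + 2 * d := not_lt.1 h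
      rcases le_or_gt s σh with hs | hs
      · have : scaleDensity m σh s = 0 := by
          unfold scaleDensity
          split_ifs with h2
          · rw [le_antisymm hs h2]; simp
          · rfl
        rw [this]; simp
      · rw [hunif _ (by linarith), ENNReal.ofReal_of_nonpos (p := ((s - σh) / 2 - d) / (s - σh)),
          mul_zero]
        exact div_nonpos_of_nonpos_of_nonneg (by linarith) (by linarith)
  simp_rw [hpt]
  rw [lintegral_indicator measurableSet_Ioi, ← ofReal_integral_eq_lintegral_ofReal
    (hint.const_mul _), integral_const_mul, hval]
  · congr 1
    rw [Real.div_rpow hσ.le hL.le, Real.rpow_neg hL.le]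
    field_simp
  · filter_upwards [ae_restrict_mem measurableSet_Ioi] with s hs
    have h' : σh + 2 * d < s := hs
    have : 0 < s := hL.trans h'
    have : 0 ≤ s - (σh + 2 * d) := by linarith
    simp only [Pi.zero_apply]
    positivity

lemma posterior_Ici {m μh σh y : ℝ} (hm : 0 < m) (hσ : 0 < σh) (hy : μh ≤ y) :
    posterior m μh σh {p | y ≤ p.2} =
      ENNReal.ofReal (1 / 2 * (σh / (σh + 2 * (y - μh))) ^ m) := by
  refine posterior_tail (S := Ici y) hm hσ (sub_nonneg.2 hy) measurableSet_Ici fun w hw => ?_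
  rw [← uniLaw_Ici (m := μh) hw (sub_nonneg.2 hy), add_sub_cancel]

lemma posterior_Iio {m μh σh y : ℝ} (hm : 0 < m) (hσ : 0 < σh) (hy : y ≤ μh) :
    posterior m μh σh {p | p.2 < y} =
      ENNReal.ofReal (1 / 2 * (σh / (σh + 2 * (μh - y))) ^ m) := by
  refine posterior_tail (S := Iio y) hm hσ (sub_nonneg.2 hy) measurableSet_Iio fun w hw => ?_
  rw [← uniLaw_Iio (m := μh) hw (sub_nonneg.2 hy), sub_sub_cancel]

lemma measurableSet_snd_lt (y : ℝ) : MeasurableSet {p : ℝ × ℝ | p.2 < y} :=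
  measurableSet_lt measurable_snd measurable_const

lemma measurableSet_le_snd (y : ℝ) : MeasurableSet {p : ℝ × ℝ | y ≤ p.2} :=
  measurableSet_le measurable_const measurable_snd

/-- The two tails at distance `d = 0` have mass one half each. -/
lemma isProbabilityMeasure_posterior {m σh : ℝ} (μh : ℝ) (hm : 0 < m) (hσ : 0 < σh) :
    IsProbabilityMeasure (posterior m μh σh) := by
  constructor
  have hu : (univ : Set (ℝ × ℝ)) = {p | p.2 < μh} ∪ {p | μh ≤ p.2} := by
    ext p; simp [lt_or_ge]
  rw [hu, measure_union _ (measurableSet_le_snd _), posterior_Iio hm hσ le_rfl,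
    posterior_Ici hm hσ le_rfl, ← ENNReal.ofReal_add]
  · simp [hσ.ne', ← two_mul]
  · simp [hσ.ne']
  · simp [hσ.ne']
  · exact disjoint_left.2 fun p h1 h2 => absurd (show μh ≤ p.2 from h2) (not_le_of_gt h1)

end PosteriorTail

/-! ### Law of the minimum and maximum of a uniform sample. -/

section OrderStatistics

lemma minStat_le (x : ℕ → ℝ) {n s : ℕ} (hs : s < n) : minStat x n ≤ x s :=
  ciInf_le (Set.finite_range fun s : Fin n => x s).bddBelow ⟨s, hs⟩

lemma le_maxStat (x : ℕ → ℝ) {n s : ℕ} (hs : s < n) : x s ≤ maxStat x n :=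
  le_ciSup (Set.finite_range fun s : Fin n => x s).bddAbove ⟨s, hs⟩

lemma exists_minStat (x : ℕ → ℝ) {n : ℕ} (hn : 0 < n) : ∃ s < n, x s = minStat x n := by
  have : Nonempty (Fin n) := ⟨⟨0, hn⟩⟩
  obtain ⟨s, hs⟩ := exists_eq_ciInf_of_finite (f := fun s : Fin n => x s)
  exact ⟨s, s.2, hs⟩

lemma exists_maxStat (x : ℕ → ℝ) {n : ℕ} (hn : 0 < n) : ∃ s < n, x s = maxStat x n := by
  have : Nonempty (Fin n) := ⟨⟨0, hn⟩⟩
  obtain ⟨s, hs⟩ := exists_eq_ciSup_of_finite (f := fun s : Fin n => x s)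
  exact ⟨s, s.2, hs⟩

lemma minStat_le_maxStat (x : ℕ → ℝ) {n : ℕ} (hn : 0 < n) : minStat x n ≤ maxStat x n :=
  (minStat_le x hn).trans (le_maxStat x hn)

/-- If the same index attains both, all observations coincide and any two indices serve. -/
lemma exists_ne_minStat_maxStat (x : ℕ → ℝ) {n : ℕ} (hn : 2 ≤ n) :
    ∃ j < n, ∃ l < n, j ≠ l ∧ x j = minStat x n ∧ x l = maxStat x n := by
  obtain ⟨j, hj, hj'⟩ := exists_minStat x (n := n) (by omega)
  obtain ⟨l, hl, hl'⟩ := exists_maxStat x (n := n) (by omega)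
  by_cases hjl : j = l
  · subst hjl
    have hall : ∀ s < n, x s = x j := fun s hs =>
      le_antisymm (hl' ▸ le_maxStat x hs) (hj' ▸ minStat_le x hs)
    refine ⟨0, by omega, 1, by omega, by omega, ?_, ?_⟩
    · rw [hall 0 (by omega), hj']
    · rw [hall 1 (by omega), hl']
  · exact ⟨j, hj, l, hl, hjl, hj', hl'⟩

variable {Ω : Type*} [MeasurableSpace Ω]

lemma measurable_minStat {Y : ℕ → Ω → ℝ} (hY : ∀ s, Measurable (Y s)) (n : ℕ) :
    Measurable fun ω => minStat (fun s => Y s ω) n :=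
  Measurable.iInf fun s : Fin n => hY s

lemma measurable_maxStat {Y : ℕ → Ω → ℝ} (hY : ∀ s, Measurable (Y s)) (n : ℕ) :
    Measurable fun ω => maxStat (fun s => Y s ω) n :=
  Measurable.iSup fun s : Fin n => hY s

lemma uniLaw_Ioi_le {m σ : ℝ} (hσ : 0 < σ) (c : ℝ) :
    uniLaw m σ (Ioi (m - σ / 2 + c)) ≤ ENNReal.ofReal (1 - c / σ) := by
  have h : Ioi (m - σ / 2 + c) ∩ Icc (m - σ / 2) (m + σ / 2) ⊆ Icc (m - σ / 2 + c) (m + σ / 2) :=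
    fun x hx => ⟨le_of_lt hx.1, hx.2.2⟩
  rw [uniLaw_apply _ _ measurableSet_Ioi]
  refine (mul_le_mul_right (measure_mono h) _).trans ?_
  rw [Real.volume_Icc, ← ENNReal.ofReal_mul (by positivity)]
  apply ENNReal.ofReal_le_ofReal
  apply le_of_eq
  field_simp
  ring

lemma uniLaw_Iio_le {m σ : ℝ} (hσ : 0 < σ) (c : ℝ) :
    uniLaw m σ (Iio (m + σ / 2 - c)) ≤ ENNReal.ofReal (1 - c / σ) := by
  have h : Iio (m + σ / 2 - c) ∩ Icc (m - σ / 2) (m + σ / 2) ⊆ Icc (m - σ / 2) (m + σ / 2 - c) :=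
    fun x hx => ⟨hx.2.1, le_of_lt hx.1⟩
  rw [uniLaw_apply _ _ measurableSet_Iio]
  refine (mul_le_mul_right (measure_mono h) _).trans ?_
  rw [Real.volume_Icc, ← ENNReal.ofReal_mul (by positivity)]
  apply ENNReal.ofReal_le_ofReal
  apply le_of_eq
  field_simp
  ring

lemma uniLaw_Icc_le (m : ℝ) {σ : ℝ} (hσ : 0 < σ) (x y : ℝ) :
    uniLaw m σ (Icc x y) ≤ ENNReal.ofReal ((y - x) / σ) := by
  rw [uniLaw_apply _ _ measurableSet_Icc]
  refine (mul_le_mul_right (measure_mono inter_subset_left) _).trans ?_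
  rw [Real.volume_Icc, ← ENNReal.ofReal_mul (by positivity), one_div_mul_eq_div]

variable {P : Measure Ω} {Y : ℕ → Ω → ℝ} {m σ : ℝ}

lemma measure_forall_mem (hY : ∀ s, Measurable (Y s)) (hlaw : ∀ s, P.map (Y s) = uniLaw m σ)
    (hind : iIndepFun Y P) (S : Finset ℕ) {B : Set ℝ} (hB : MeasurableSet B) :
    P {ω | ∀ s ∈ S, Y s ω ∈ B} = uniLaw m σ B ^ S.card := by
  have h := hind.measure_inter_preimage_eq_mul S (sets := fun _ => B) fun _ _ => hB
  have hset : {ω | ∀ s ∈ S, Y s ω ∈ B} = ⋂ i ∈ S, Y i ⁻¹' B := by ext; simp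
  rw [hset, h, Finset.prod_congr rfl fun s _ => by
    rw [← Measure.map_apply (hY s) hB, hlaw s], Finset.prod_const]

lemma measure_lt_minStat (hY : ∀ s, Measurable (Y s)) (hlaw : ∀ s, P.map (Y s) = uniLaw m σ)
    (hind : iIndepFun Y P) (hσ : 0 < σ) (c : ℝ) (n : ℕ) :
    P {ω | m - σ / 2 + c < minStat (fun s => Y s ω) n} ≤ ENNReal.ofReal (1 - c / σ) ^ n := by
  calc P {ω | m - σ / 2 + c < minStat (fun s => Y s ω) n}
      ≤ P {ω | ∀ s ∈ Finset.range n, Y s ω ∈ Ioi (m - σ / 2 + c)} :=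
        measure_mono fun ω hω s hs =>
          lt_of_lt_of_le hω (minStat_le (fun s => Y s ω) (Finset.mem_range.1 hs))
    _ ≤ _ := by
      rw [measure_forall_mem hY hlaw hind _ measurableSet_Ioi, Finset.card_range]
      exact pow_le_pow_left' (uniLaw_Ioi_le hσ c) n

lemma measure_maxStat_lt (hY : ∀ s, Measurable (Y s)) (hlaw : ∀ s, P.map (Y s) = uniLaw m σ)
    (hind : iIndepFun Y P) (hσ : 0 < σ) (c : ℝ) (n : ℕ) :
    P {ω | maxStat (fun s => Y s ω) n < m + σ / 2 - c} ≤ ENNReal.ofReal (1 - c / σ) ^ n := by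
  calc P {ω | maxStat (fun s => Y s ω) n < m + σ / 2 - c}
      ≤ P {ω | ∀ s ∈ Finset.range n, Y s ω ∈ Iio (m + σ / 2 - c)} :=
        measure_mono fun ω hω s hs =>
          lt_of_le_of_lt (le_maxStat (fun s => Y s ω) (Finset.mem_range.1 hs)) hω
    _ ≤ _ := by
      rw [measure_forall_mem hY hlaw hind _ measurableSet_Iio, Finset.card_range]
      exact pow_le_pow_left' (uniLaw_Iio_le hσ c) n

lemma ae_mem_support (hY : ∀ s, Measurable (Y s)) (hlaw : ∀ s, P.map (Y s) = uniLaw m σ) :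
    ∀ᵐ ω ∂P, ∀ s, Y s ω ∈ Icc (m - σ / 2) (m + σ / 2) := by
  rw [ae_all_iff]
  intro s
  have h : ∀ᵐ x ∂(P.map (Y s)), x ∈ Icc (m - σ / 2) (m + σ / 2) := by
    rw [hlaw]; exact uniLaw_compl_Icc m σ
  exact ae_of_ae_map (hY s).aemeasurable h

/-- The pair of observations is independent of the remaining ones, each of which falls between the
pair with probability at most `(y - x) / σ`. -/
lemma lintegral_pair_le [IsProbabilityMeasure P] (hY : ∀ s, Measurable (Y s))
    (hlaw : ∀ s, P.map (Y s) = uniLaw m σ) (hind : iIndepFun Y P) (hσ : 0 < σ)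
    {f : ℝ × ℝ → ℝ≥0∞} (hf : Measurable f) {j l : ℕ} (hjl : j ≠ l) (S : Finset ℕ)
    (hS : Disjoint {j, l} S) :
    ∫⁻ ω, f (Y j ω, Y l ω) *
        {ω | ∀ s ∈ S, Y s ω ∈ Icc (Y j ω) (Y l ω)}.indicator (fun _ => 1) ω ∂P ≤
      ∫⁻ x, ∫⁻ y, f (x, y) * ENNReal.ofReal ((y - x) / σ) ^ S.card ∂uniLaw m σ ∂uniLaw m σ := by
  have := isProbabilityMeasure_uniLaw m hσ
  set W : Ω → ℝ × ℝ := fun ω => (Y j ω, Y l ω)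
  set Z : Ω → S → ℝ := fun ω s => Y s ω
  have hW : Measurable W := (hY j).prodMk (hY l)
  have hZ : Measurable Z := measurable_pi_lambda _ fun s => hY s
  have hWZ : IndepFun W Z P := by
    have h := hind.indepFun_finset {j, l} S hS hY
    have hφ : Measurable fun g : ({j, l} : Finset ℕ) → ℝ =>
        (g ⟨j, by simp⟩, g ⟨l, by simp⟩) := by fun_prop
    exact h.comp hφ measurable_id
  have hWlaw : P.map W = (uniLaw m σ).prod (uniLaw m σ) := by
    rw [(indepFun_iff_map_prod_eq_prod_map_map (hY j).aemeasurable (hY l).aemeasurable).1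
      (hind.indepFun hjl), hlaw, hlaw]
  have hE : MeasurableSet {q : (ℝ × ℝ) × (S → ℝ) | ∀ s, q.2 s ∈ Icc q.1.1 q.1.2} := by
    rw [ofPred_forall]
    refine MeasurableSet.iInter fun s => ?_
    have h1 : Measurable fun q : (ℝ × ℝ) × (S → ℝ) => q.1.1 := by fun_prop
    have h2 : Measurable fun q : (ℝ × ℝ) × (S → ℝ) => q.2 s := by fun_prop
    have h3 : Measurable fun q : (ℝ × ℝ) × (S → ℝ) => q.1.2 := by fun_prop
    exact (measurableSet_le h1 h2).inter (measurableSet_le h2 h3)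
  set E := {q : (ℝ × ℝ) × (S → ℝ) | ∀ s, q.2 s ∈ Icc q.1.1 q.1.2}
  have hF : Measurable fun q : (ℝ × ℝ) × (S → ℝ) => f q.1 * E.indicator (fun _ => 1) q :=
    (hf.comp measurable_fst).mul (measurable_const.indicator hE)
  have : IsProbabilityMeasure (P.map Z) := Measure.isProbabilityMeasure_map hZ.aemeasurable
  calc ∫⁻ ω, f (Y j ω, Y l ω) *
        {ω | ∀ s ∈ S, Y s ω ∈ Icc (Y j ω) (Y l ω)}.indicator (fun _ => 1) ω ∂P
      = ∫⁻ ω, f (W ω, Z ω).1 * E.indicator (fun _ => 1) (W ω, Z ω) ∂P := by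
        refine lintegral_congr fun ω => ?_
        congr 1
        by_cases h : ∀ s ∈ S, Y s ω ∈ Icc (Y j ω) (Y l ω)
        · rw [indicator_of_mem (by exact h), indicator_of_mem]
          exact fun s => h s s.2
        · rw [indicator_of_notMem (by exact h), indicator_of_notMem]
          exact fun h' => h fun s hs => h' ⟨s, hs⟩
    _ = ∫⁻ q, f q.1 * E.indicator (fun _ => 1) q ∂((P.map W).prod (P.map Z)) := by
        rw [← (indepFun_iff_map_prod_eq_prod_map_map hW.aemeasurable hZ.aemeasurable).1 hWZ,
          lintegral_map hF (hW.prodMk hZ)]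
    _ = ∫⁻ w, f w * P {ω | ∀ s ∈ S, Y s ω ∈ Icc w.1 w.2}
          ∂((uniLaw m σ).prod (uniLaw m σ)) := by
        rw [lintegral_prod _ hF.aemeasurable, hWlaw]
        refine lintegral_congr fun w => ?_
        have hEw : MeasurableSet (Prod.mk w ⁻¹' E) := measurable_prodMk_left hE
        have hind' : (fun z : S → ℝ => E.indicator (fun _ => (1 : ℝ≥0∞)) (w, z)) =
            (Prod.mk w ⁻¹' E).indicator (fun _ => 1) := rfl
        refine (lintegral_const_mul (f w) (hind' ▸ measurable_const.indicator hEw :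
          Measurable fun z : S → ℝ => E.indicator (fun _ => (1 : ℝ≥0∞)) (w, z))).trans ?_
        congr 1
        rw [hind', lintegral_indicator_const hEw, one_mul, Measure.map_apply hZ hEw]
        congr 1
        ext ω
        exact ⟨fun h s hs => h ⟨s, hs⟩, fun h s => h s s.2⟩
    _ ≤ ∫⁻ w, f w * ENNReal.ofReal ((w.2 - w.1) / σ) ^ S.card
          ∂((uniLaw m σ).prod (uniLaw m σ)) := by
        refine lintegral_mono fun w => mul_le_mul_right ?_ _
        rw [measure_forall_mem hY hlaw hind S measurableSet_Icc]
        exact pow_le_pow_left' (uniLaw_Icc_le m hσ _ _) _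
    _ = _ := by
        rw [lintegral_prod]
        exact (hf.mul ((by fun_prop : Measurable fun w : ℝ × ℝ => (w.2 - w.1) / σ).ennreal_ofReal.pow_const _)).aemeasurable

/-- A one-sided substitute for the joint density of the extremes: sum over the `n * (n - 1)` ordered
pairs of indices that may attain them. Ties only make the sum larger, so no almost sure distinctness
is needed. -/
lemma lintegral_minStat_maxStat_le [IsProbabilityMeasure P] (hY : ∀ s, Measurable (Y s))
    (hlaw : ∀ s, P.map (Y s) = uniLaw m σ) (hind : iIndepFun Y P) (hσ : 0 < σ)
    {f : ℝ × ℝ → ℝ≥0∞} (hf : Measurable f) {n : ℕ} (hn : 2 ≤ n) :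
    ∫⁻ ω, f (minStat (fun s => Y s ω) n, maxStat (fun s => Y s ω) n) ∂P ≤
      n * (n - 1 : ℕ) * ∫⁻ x, ∫⁻ y, f (x, y) * ENNReal.ofReal ((y - x) / σ) ^ (n - 2)
        ∂uniLaw m σ ∂uniLaw m σ := by
  set I := ∫⁻ x, ∫⁻ y, f (x, y) * ENNReal.ofReal ((y - x) / σ) ^ (n - 2) ∂uniLaw m σ ∂uniLaw m σ
  set S : ℕ → ℕ → Finset ℕ := fun j l => Finset.range n \ {j, l}
  set g : ℕ → ℕ → Ω → ℝ≥0∞ := fun j l ω => f (Y j ω, Y l ω) *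
        {ω | ∀ s ∈ S j l, Y s ω ∈ Icc (Y j ω) (Y l ω)}.indicator (fun _ => 1) ω with hg
  have hgm : ∀ j l, Measurable (g j l) := by
    intro j l
    refine (hf.comp ((hY j).prodMk (hY l))).mul (measurable_const.indicator ?_)
    simp only [ofPred_forall]
    refine MeasurableSet.iInter fun s => MeasurableSet.iInter fun _ => ?_
    exact (measurableSet_le (hY j) (hY s)).inter (measurableSet_le (hY s) (hY l))
  have hpt : ∀ ω, f (minStat (fun s => Y s ω) n, maxStat (fun s => Y s ω) n) ≤
      ∑ j ∈ Finset.range n, ∑ l ∈ (Finset.range n).erase j, g j l ω := by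
    intro ω
    obtain ⟨j, hj, l, hl, hjl, hj', hl'⟩ := exists_ne_minStat_maxStat (fun s => Y s ω) hn
    have h1 : f (minStat (fun s => Y s ω) n, maxStat (fun s => Y s ω) n) = g j l ω := by
      simp only [hg]
      rw [indicator_of_mem, ← hj', ← hl', mul_one]
      intro s hs
      have hs' : s < n := by simp [S] at hs; exact hs.1
      exact ⟨hj'.trans_le (minStat_le (fun s => Y s ω) hs'),
        (le_maxStat (fun s => Y s ω) hs').trans_eq hl'.symm⟩
    rw [h1]
    refine le_trans ?_ (Finset.single_le_sum (fun _ _ => zero_le) (Finset.mem_range.2 hj))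
    exact Finset.single_le_sum (f := fun l => g j l ω) (fun _ _ => zero_le)
      (Finset.mem_erase.2 ⟨hjl.symm, Finset.mem_range.2 hl⟩)
  have hcard : ∀ j ∈ Finset.range n, ∀ l ∈ (Finset.range n).erase j, (S j l).card = n - 2 := by
    intro j hj l hl
    have hl' := Finset.mem_erase.1 hl
    rw [Finset.card_sdiff_of_subset, Finset.card_range, Finset.card_pair hl'.1.symm]
    intro s hs
    simp only [Finset.mem_insert, Finset.mem_singleton] at hs
    rcases hs with rfl | rfl
    · exact hj
    · exact hl'.2
  calc _ ≤ ∫⁻ ω, ∑ j ∈ Finset.range n, ∑ l ∈ (Finset.range n).erase j, g j l ω ∂P :=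
        lintegral_mono hpt
    _ = ∑ j ∈ Finset.range n, ∑ l ∈ (Finset.range n).erase j, ∫⁻ ω, g j l ω ∂P := by
        rw [lintegral_finsetSum _ fun j _ => Finset.measurable_sum _ fun l _ => hgm j l]
        exact Finset.sum_congr rfl fun j _ => lintegral_finsetSum _ fun l _ => hgm j l
    _ ≤ ∑ j ∈ Finset.range n, ∑ l ∈ (Finset.range n).erase j, I := by
        refine Finset.sum_le_sum fun j hj => Finset.sum_le_sum fun l hl => ?_
        have := lintegral_pair_le hY hlaw hind hσ hf (Finset.ne_of_mem_erase hl).symm (S j l)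
          Finset.disjoint_sdiff
        rwa [hcard j hj l hl] at this
    _ = n * (n - 1 : ℕ) * I := by
        rw [Finset.sum_congr rfl fun j hj => by
          rw [Finset.sum_const, Finset.card_erase_of_mem hj, Finset.card_range]]
        rw [Finset.sum_const, Finset.card_range, nsmul_eq_mul, nsmul_eq_mul, mul_assoc]

end OrderStatistics

/-! ### Integrals of the excess ratio, in the three regimes of `k`. -/

section ExcessRatio

/-- The `q`-th power of the ratio of `2 * (c - x)` to the truncated range, on the event that this
ratio exceeds `1`, as a function of the minimum `p.1` and the maximum `p.2`. -/
noncomputable def excessRatio (n : ℕ) (q c : ℝ) (p : ℝ × ℝ) : ℝ≥0∞ :=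
  if p.1 ≤ p.2 ∧ max (1 / (n : ℝ)) (p.2 - p.1) < 2 * (c - p.1) then
    ENNReal.ofReal ((2 * (c - p.1) / max (1 / (n : ℝ)) (p.2 - p.1)) ^ q) else 0

lemma measurable_excessRatio (n : ℕ) (q c : ℝ) : Measurable (excessRatio n q c) := by
  unfold excessRatio
  have h1 : Measurable fun p : ℝ × ℝ => max (1 / (n : ℝ)) (p.2 - p.1) := by fun_prop
  have h2 : Measurable fun p : ℝ × ℝ => 2 * (c - p.1) := by fun_prop
  refine Measurable.ite ((measurableSet_le measurable_fst measurable_snd).inter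
    (measurableSet_lt h1 h2)) ?_ measurable_const
  exact ((h2.div h1).pow_const q).ennreal_ofReal

lemma lintegral_two_mul_sub_rpow {a c J M : ℝ} (hM : 0 ≤ M) (hJ : 0 ≤ J) :
    ∫⁻ x in Ico a c, ENNReal.ofReal (J * (2 * (c - x)) ^ M) ≤
      ENNReal.ofReal (J * (max (2 * (c - a)) 0 ^ (M + 1) / (2 * (M + 1)))) := by
  rcases le_or_gt c a with h | h
  · simp [Ico_eq_empty (not_lt.2 h)]
  · rw [max_eq_left (by linarith), restrict_Ico_eq_restrict_Ioc]
    have hcont : Continuous fun x : ℝ => J * (2 * (c - x)) ^ M :=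
      continuous_const.mul (Continuous.rpow_const (by fun_prop) fun _ => Or.inr hM)
    rw [← ofReal_integral_eq_lintegral_ofReal, ← intervalIntegral.integral_of_le h.le,
      intervalIntegral.integral_const_mul]
    · have : ∀ x : ℝ, 2 * (c - x) = 2 * c - 2 * x := fun x => by ring
      simp_rw [this]
      rw [intervalIntegral.integral_comp_sub_mul (fun x : ℝ => x ^ M) two_ne_zero, sub_self,
        integral_rpow (Or.inl (by linarith)), Real.zero_rpow (by linarith)]
      apply ENNReal.ofReal_le_ofReal
      rw [smul_eq_mul, sub_zero]
      apply le_of_eq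
      field_simp
    · exact (hcont.integrableOn_Icc (a := a) (b := c)).mono_set Ioc_subset_Icc_self
    · filter_upwards [ae_restrict_mem measurableSet_Ioc] with x hx
      have : 0 ≤ 2 * (c - x) := by linarith [hx.2]
      simp only [Pi.zero_apply]
      positivity

variable {Ω : Type*} [MeasurableSpace Ω] {P : Measure Ω} {Y : ℕ → Ω → ℝ} {m σ : ℝ}

/-- Separates the integral over the range `s` from that over the minimum `x`. The dependence on the
prior enters only through the range bound `J * w ^ M` with `w = 2 * (c - x)`; the minimum is then
integrated over `x < c`. -/
lemma lintegral_excessRatio_le [IsProbabilityMeasure P] (hY : ∀ s, Measurable (Y s))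
    (hlaw : ∀ s, P.map (Y s) = uniLaw m σ) (hind : iIndepFun Y P) (hσ : 0 < σ)
    {n : ℕ} (hn : 2 ≤ n) {q c J M : ℝ} (hJ : 0 ≤ J) (hM : 0 ≤ M)
    (hc : 2 * (c - (m - σ / 2)) ≤ σ)
    (hφ : ∀ w, 0 < w → w ≤ σ → ∫⁻ s in Ioo 0 w,
      ENNReal.ofReal (s ^ (n - 2) * (w / max (1 / (n : ℝ)) s) ^ q) ≤ ENNReal.ofReal (J * w ^ M)) :
    ∫⁻ ω, excessRatio n q c (minStat (fun s => Y s ω) n, maxStat (fun s => Y s ω) n) ∂P ≤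
      ENNReal.ofReal (n * (n - 1) / σ ^ n *
        (J * (max (2 * (c - (m - σ / 2))) 0 ^ (M + 1) / (2 * (M + 1))))) := by
  refine (lintegral_minStat_maxStat_le hY hlaw hind hσ (measurable_excessRatio n q c) hn).trans ?_
  have hn0 : (0 : ℝ) < n := by positivity
  have hinner : ∀ x, m - σ / 2 ≤ x →
      ∫⁻ y, excessRatio n q c (x, y) * ENNReal.ofReal ((y - x) / σ) ^ (n - 2) ∂uniLaw m σ ≤
        ENNReal.ofReal (1 / σ ^ (n - 1)) *
          (Iio c).indicator (fun x => ENNReal.ofReal (J * (2 * (c - x)) ^ M)) x := by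
    intro x hx
    set w := 2 * (c - x) with hw
    set G : ℝ → ℝ≥0∞ := (Ico 0 w).indicator fun s =>
      ENNReal.ofReal (1 / σ ^ (n - 2)) *
        ENNReal.ofReal (s ^ (n - 2) * (w / max (1 / (n : ℝ)) s) ^ q) with hG
    have hle : ∀ y, excessRatio n q c (x, y) * ENNReal.ofReal ((y - x) / σ) ^ (n - 2) ≤
        G (y - x) := by
      intro y
      unfold excessRatio
      split_ifs with h
      · obtain ⟨h1, h2⟩ := h
        simp only at h1 h2
        have h3 : 0 ≤ y - x := sub_nonneg.2 h1
        have h4 : 0 < max (1 / (n : ℝ)) (y - x) := lt_max_of_lt_left (by positivity)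
        have h5 : 0 ≤ 2 * (c - x) := (h4.trans h2).le
        have h6 : 0 ≤ (2 * (c - x) / max (1 / (n : ℝ)) (y - x)) ^ q :=
          Real.rpow_nonneg (div_nonneg h5 h4.le) q
        rw [hG, indicator_of_mem (show y - x ∈ Ico 0 w from ⟨h3, (le_max_right _ _).trans_lt h2⟩),
          ← ENNReal.ofReal_pow (div_nonneg h3 hσ.le), ← ENNReal.ofReal_mul h6,
          ← ENNReal.ofReal_mul (by positivity)]
        apply ENNReal.ofReal_le_ofReal
        rw [div_pow]
        apply le_of_eq
        ring
      · rw [zero_mul]; exact zero_le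
    have hGint : ∫⁻ s, G s ≤ ENNReal.ofReal (1 / σ ^ (n - 2)) *
        (Iio c).indicator (fun x => ENNReal.ofReal (J * (2 * (c - x)) ^ M)) x := by
      rw [hG, lintegral_indicator measurableSet_Ico]
      by_cases hxc : x < c
      · rw [indicator_of_mem (show x ∈ Iio c from hxc), lintegral_const_mul' _ _ ENNReal.ofReal_ne_top,
          ← restrict_Ioo_eq_restrict_Ico]
        gcongr
        exact hφ w (by linarith) (by linarith)
      · rw [Ico_eq_empty (by linarith)]
        simp
    rw [lintegral_uniLaw]
    -- The restriction to the support is dropped, and translation invariance turns the maximum into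
    -- the range.
    calc _ ≤ ENNReal.ofReal (1 / σ) * ∫⁻ y, G (y - x) := by
          exact mul_le_mul_right ((lintegral_mono hle).trans (setLIntegral_le_lintegral _ _)) _
      _ = ENNReal.ofReal (1 / σ) * ∫⁻ y, G y := by
          rw [lintegral_sub_right_eq_self]
      _ ≤ _ := by
          refine (mul_le_mul_right hGint _).trans_eq ?_
          rw [← mul_assoc, ← ENNReal.ofReal_mul (by positivity)]
          congr 2
          rw [show n - 1 = n - 2 + 1 by omega, pow_succ]
          field_simp
  have houter : ∫⁻ x, ∫⁻ y, excessRatio n q c (x, y) * ENNReal.ofReal ((y - x) / σ) ^ (n - 2)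
        ∂uniLaw m σ ∂uniLaw m σ ≤ ENNReal.ofReal (1 / σ ^ n) * ENNReal.ofReal
          (J * (max (2 * (c - (m - σ / 2))) 0 ^ (M + 1) / (2 * (M + 1)))) := by
    rw [lintegral_uniLaw]
    calc _ ≤ ENNReal.ofReal (1 / σ) * ∫⁻ x in Icc (m - σ / 2) (m + σ / 2),
          ENNReal.ofReal (1 / σ ^ (n - 1)) *
          (Iio c).indicator (fun x => ENNReal.ofReal (J * (2 * (c - x)) ^ M)) x := by
          exact mul_le_mul_right (setLIntegral_mono' measurableSet_Icc fun x hx => hinner x hx.1) _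
      _ ≤ ENNReal.ofReal (1 / σ) * (ENNReal.ofReal (1 / σ ^ (n - 1)) *
          ∫⁻ x in Ico (m - σ / 2) c, ENNReal.ofReal (J * (2 * (c - x)) ^ M)) := by
          rw [lintegral_const_mul' _ _ ENNReal.ofReal_ne_top]
          refine mul_le_mul_right (mul_le_mul_right ?_ _) _
          rw [lintegral_indicator measurableSet_Iio, Measure.restrict_restrict measurableSet_Iio]
          exact lintegral_mono_set fun x hx => ⟨hx.2.1, hx.1⟩
      _ ≤ ENNReal.ofReal (1 / σ) * (ENNReal.ofReal (1 / σ ^ (n - 1)) * ENNReal.ofReal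
          (J * (max (2 * (c - (m - σ / 2))) 0 ^ (M + 1) / (2 * (M + 1))))) := by
          gcongr
          exact lintegral_two_mul_sub_rpow hM hJ
      _ = _ := by
          rw [← mul_assoc, ← ENNReal.ofReal_mul (by positivity)]
          congr 2
          obtain ⟨n', rfl⟩ : ∃ n', n = n' + 1 := ⟨n - 1, by omega⟩
          rw [Nat.add_sub_cancel, pow_succ]
          field_simp
  refine (mul_le_mul_right houter _).trans_eq ?_
  have h1 : ((n : ℝ≥0∞) * (n - 1 : ℕ)) = ENNReal.ofReal (n * (n - 1)) := by
    rw [← ENNReal.ofReal_natCast, ← ENNReal.ofReal_natCast, ← ENNReal.ofReal_mul (by positivity),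
      Nat.cast_sub (by omega), Nat.cast_one]
  have h2 : (1 : ℝ) ≤ n := by exact_mod_cast (by omega : 1 ≤ n)
  have h3 : (0 : ℝ) ≤ n * (n - 1) := mul_nonneg hn0.le (by linarith)
  rw [h1, ← mul_assoc, ← ENNReal.ofReal_mul h3, ← ENNReal.ofReal_mul (by positivity)]
  congr 1
  ring

/-- Truncation is not needed here: the powers of `s` combine to `s ^ (-k)`, which is integrable at
`0`. -/
lemma lintegral_truncated_of_lt_one {n : ℕ} {k w : ℝ} (hn : 2 ≤ n) (hk : k < 1)
    (hq : 0 < (n : ℝ) + k - 2) (hw : 0 < w) :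
    ∫⁻ s in Ioo 0 w, ENNReal.ofReal (s ^ (n - 2) * (w / max (1 / (n : ℝ)) s) ^ ((n : ℝ) + k - 2)) ≤
      ENNReal.ofReal (1 / (1 - k) * w ^ ((n : ℝ) - 1)) := by
  have hn0 : (0 : ℝ) < n := by positivity
  calc _ ≤ ∫⁻ s in Ioo 0 w, ENNReal.ofReal (w ^ ((n : ℝ) + k - 2) * s ^ (-k)) := by
        refine setLIntegral_mono' measurableSet_Ioo fun s hs => ENNReal.ofReal_le_ofReal ?_
        have hs0 : 0 < s := hs.1
        have h1 : (w / max (1 / (n : ℝ)) s) ^ ((n : ℝ) + k - 2) ≤ (w / s) ^ ((n : ℝ) + k - 2) := by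
          apply Real.rpow_le_rpow (by positivity) _ hq.le
          gcongr
          exact le_max_right _ _
        refine (mul_le_mul_of_nonneg_left h1 (by positivity)).trans_eq ?_
        rw [Real.div_rpow hw.le hs0.le, ← Real.rpow_natCast s (n - 2), Nat.cast_sub hn,
          Nat.cast_ofNat, mul_div_left_comm, ← Real.rpow_sub hs0]
        congr 2
        ring
    _ = ENNReal.ofReal (∫ s in (0 : ℝ)..w, w ^ ((n : ℝ) + k - 2) * s ^ (-k)) := by
        rw [restrict_Ioo_eq_restrict_Ioc, intervalIntegral.integral_of_le hw.le,
          ofReal_integral_eq_lintegral_ofReal]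
        · exact ((intervalIntegral.intervalIntegrable_rpow' (a := 0) (b := w)
            (r := -k) (by linarith)).1).const_mul _
        · filter_upwards [ae_restrict_mem measurableSet_Ioc] with s hs
          have : 0 < s := hs.1
          simp only [Pi.zero_apply]
          positivity
    _ ≤ _ := by
        apply ENNReal.ofReal_le_ofReal
        rw [intervalIntegral.integral_const_mul, integral_rpow (Or.inl (by linarith)),
          Real.zero_rpow (by linarith), sub_zero, mul_div_assoc', ← Real.rpow_add hw,
          one_div_mul_eq_div, show (n : ℝ) + k - 2 + (-k + 1) = n - 1 by ring,
          show -k + 1 = 1 - k by ring]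

/-- After enlarging `s ^ (n - 2)` to the power of `max (1/n) s`, the integrand is a multiple of `max
(1/n) s ^ (-k)`. Ranges up to `1/n` contribute `(1/n) * n ^ k = n ^ (k - 1)`, larger ones the tail
`I`. -/
lemma lintegral_truncated_le {n : ℕ} {k w I : ℝ} (hn : 2 ≤ n) (hI : 0 ≤ I)
    (hw : 0 < w) (htail : ∫⁻ s in Ioo (1 / (n : ℝ)) w, ENNReal.ofReal (s ^ (-k)) ≤
      ENNReal.ofReal I) :
    ∫⁻ s in Ioo 0 w, ENNReal.ofReal (s ^ (n - 2) * (w / max (1 / (n : ℝ)) s) ^ ((n : ℝ) + k - 2)) ≤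
      ENNReal.ofReal (((n : ℝ) ^ (k - 1) + I) * w ^ ((n : ℝ) + k - 2)) := by
  have hn0 : (0 : ℝ) < n := by positivity
  have hn2 : (2 : ℝ) ≤ n := by exact_mod_cast hn
  have hmax : ∀ s, 0 < max (1 / (n : ℝ)) s := fun s => lt_max_of_lt_left (by positivity)
  calc _ ≤ ∫⁻ s in Ioo 0 w, ENNReal.ofReal (w ^ ((n : ℝ) + k - 2)) *
          ENNReal.ofReal (max (1 / (n : ℝ)) s ^ (-k)) := by
        refine setLIntegral_mono' measurableSet_Ioo fun s hs => ?_
        rw [← ENNReal.ofReal_mul (by positivity)]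
        apply ENNReal.ofReal_le_ofReal
        have hs0 : 0 < s := hs.1
        have h1 : s ^ (n - 2) ≤ max (1 / (n : ℝ)) s ^ (n - 2) :=
          pow_le_pow_left₀ hs0.le (le_max_right _ _) _
        refine (mul_le_mul_of_nonneg_right h1
          (Real.rpow_nonneg (div_nonneg hw.le (hmax s).le) _)).trans_eq ?_
        rw [Real.div_rpow hw.le (hmax s).le, ← Real.rpow_natCast _ (n - 2), Nat.cast_sub hn,
          Nat.cast_ofNat, mul_div_left_comm, ← Real.rpow_sub (hmax s)]
        congr 2
        ring
    _ = ENNReal.ofReal (w ^ ((n : ℝ) + k - 2)) *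
          ∫⁻ s in Ioo 0 w, ENNReal.ofReal (max (1 / (n : ℝ)) s ^ (-k)) :=
        lintegral_const_mul' _ _ ENNReal.ofReal_ne_top
    _ ≤ ENNReal.ofReal (w ^ ((n : ℝ) + k - 2)) *
          (ENNReal.ofReal ((n : ℝ) ^ (k - 1)) + ENNReal.ofReal I) := by
        gcongr
        have hsub : Ioo 0 w ⊆ Ioc 0 (1 / (n : ℝ)) ∪ Ioo (1 / (n : ℝ)) w := fun s hs => by
          rcases le_or_gt s (1 / (n : ℝ)) with h | h
          · exact Or.inl ⟨hs.1, h⟩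
          · exact Or.inr ⟨h, hs.2⟩
        refine (lintegral_mono_set hsub).trans ((lintegral_union_le _ _ _).trans ?_)
        gcongr
        · calc _ = ∫⁻ s in Ioc 0 (1 / (n : ℝ)), ENNReal.ofReal ((1 / (n : ℝ)) ^ (-k)) := by
                refine setLIntegral_congr_fun measurableSet_Ioc fun s hs => ?_
                rw [max_eq_left hs.2]
            _ ≤ _ := by
                rw [setLIntegral_const, Real.volume_Ioc, sub_zero,
                  ← ENNReal.ofReal_mul (by positivity)]
                apply ENNReal.ofReal_le_ofReal
                rw [one_div, Real.inv_rpow hn0.le, Real.rpow_neg hn0.le, inv_inv,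
                  Real.rpow_sub_one hn0.ne']
                rfl
        · refine le_trans (le_of_eq ?_) htail
          refine setLIntegral_congr_fun measurableSet_Ioo fun s hs => ?_
          rw [max_eq_right hs.1.le]
    _ = _ := by
        rw [← ENNReal.ofReal_add (by positivity) hI, ← ENNReal.ofReal_mul (by positivity), mul_comm]

lemma lintegral_truncated_of_eq_one {n : ℕ} {w σ : ℝ} (hn : 2 ≤ n) (hw : 0 < w) (hwσ : w ≤ σ) :
    ∫⁻ s in Ioo 0 w, ENNReal.ofReal (s ^ (n - 2) * (w / max (1 / (n : ℝ)) s) ^ ((n : ℝ) + 1 - 2)) ≤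
      ENNReal.ofReal ((1 + Real.log (1 + n * σ)) * w ^ ((n : ℝ) - 1)) := by
  have hn0 : (0 : ℝ) < n := by positivity
  have hσ : 0 < σ := hw.trans_le hwσ
  have hlog : 0 ≤ Real.log (1 + n * σ) := Real.log_nonneg (by nlinarith [mul_pos hn0 hσ])
  have h := lintegral_truncated_le (n := n) (k := 1) (w := w) hn hlog hw ?_
  · refine h.trans_eq ?_
    rw [sub_self, Real.rpow_zero]
    congr 3
    ring
  · rcases le_or_gt w (1 / (n : ℝ)) with h | h
    · rw [Ioo_eq_empty (not_lt.2 h)]; simp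
    · have h1 : 0 < 1 / (n : ℝ) := by positivity
      have hno : (0 : ℝ) ∉ uIcc (1 / (n : ℝ)) w := notMem_uIcc_of_lt h1 hw
      have hcongr : ∫⁻ s in Ioo (1 / (n : ℝ)) w, ENNReal.ofReal (s ^ (-1 : ℝ)) =
          ∫⁻ s in Ioo (1 / (n : ℝ)) w, ENNReal.ofReal s⁻¹ := by
        simp_rw [Real.rpow_neg_one]
      rw [hcongr, restrict_Ioo_eq_restrict_Ioc, ← ofReal_integral_eq_lintegral_ofReal,
        ← intervalIntegral.integral_of_le h.le, integral_inv hno]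
      · apply ENNReal.ofReal_le_ofReal
        apply Real.log_le_log (by positivity)
        rw [div_div_eq_mul_div, div_one]
        nlinarith
      · exact ((intervalIntegral.intervalIntegrable_inv (f := fun x => x)
          (fun x hx => fun h0 => hno (h0 ▸ hx)) continuousOn_id).1)
      · filter_upwards [ae_restrict_mem measurableSet_Ioc] with s hs
        have : 0 < s := h1.trans hs.1
        simp only [Pi.zero_apply]
        positivity

lemma lintegral_truncated_of_one_lt {n : ℕ} {k w : ℝ} (hn : 2 ≤ n) (hk : 1 < k) (hw : 0 < w) :
    ∫⁻ s in Ioo 0 w, ENNReal.ofReal (s ^ (n - 2) * (w / max (1 / (n : ℝ)) s) ^ ((n : ℝ) + k - 2)) ≤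
      ENNReal.ofReal (k / (k - 1) * (n : ℝ) ^ (k - 1) * w ^ ((n : ℝ) + k - 2)) := by
  have hn0 : (0 : ℝ) < n := by positivity
  have hk1 : 0 < k - 1 := by linarith
  have h := lintegral_truncated_le (n := n) (k := k) (w := w) (I := (n : ℝ) ^ (k - 1) / (k - 1))
    hn (by positivity) hw ?_
  · refine h.trans_eq ?_
    congr 2
    field_simp
    ring
  · have h1 : 0 < 1 / (n : ℝ) := by positivity
    refine (lintegral_mono_set Ioo_subset_Ioi_self).trans ?_
    rw [← ofReal_integral_eq_lintegral_ofReal (integrableOn_Ioi_rpow_of_lt (by linarith) h1),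
      integral_Ioi_rpow_of_lt (by linarith) h1]
    · apply ENNReal.ofReal_le_ofReal
      rw [one_div, Real.inv_rpow hn0.le, ← Real.rpow_neg hn0.le, neg_div, ← div_neg]
      rw [show -(-k + 1) = k - 1 by ring]
    · filter_upwards [ae_restrict_mem measurableSet_Ioi] with s hs
      have : 0 < s := h1.trans hs
      simp only [Pi.zero_apply]
      positivity

end ExcessRatio

/-! ### The sampling law of TS-T and pointwise bounds for the odds. -/

section Odds

lemma n0_cast (k : ℝ) : (n0 k : ℝ) = max 2 (3 - (⌈k⌉ : ℝ)) := by
  have h : ((n0 k : ℤ) : ℝ) = ((max 2 (3 - ⌈k⌉) : ℤ) : ℝ) := by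
    rw [n0, Int.toNat_of_nonneg (le_max_of_le_left (by norm_num))]
  push_cast at h
  exact h

lemma two_le_n0 (k : ℝ) : 2 ≤ n0 k := by
  have h : (2 : ℝ) ≤ n0 k := by rw [n0_cast]; exact le_max_left _ _
  exact_mod_cast h

/-- The reason for the length of the initial phase: the posterior index `n + k - 2` is positive from
the first sampled round on. -/
lemma two_sub_le_n0 (k : ℝ) : 2 - k < n0 k := by
  rw [n0_cast]
  exact lt_max_of_lt_right (by linarith [Int.ceil_lt_add_one k])

lemma sub_n0_lt {k : ℝ} (n : ℕ) : (n : ℝ) - n0 k < n + k - 2 := by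
  linarith [two_sub_le_n0 k]

lemma posterior_index_pos {k : ℝ} {n : ℕ} (hn : n0 k ≤ n) : 0 < (n : ℝ) + k - 2 := by
  have h : (n0 k : ℝ) ≤ n := by exact_mod_cast hn
  linarith [two_sub_le_n0 k]

lemma truncMax_sub_minStat (x : ℕ → ℝ) (n : ℕ) :
    truncMax x n - minStat x n = max (1 / (n : ℝ)) (maxStat x n - minStat x n) := by
  rw [truncMax, ← max_sub_sub_right, add_sub_cancel_left]

lemma truncRange_pos (x : ℕ → ℝ) {n : ℕ} (hn : 0 < n) : 0 < truncMax x n - minStat x n := by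
  rw [truncMax_sub_minStat]
  exact lt_max_of_lt_left (by positivity)

lemma tstLaw_eq (k : ℝ) (n : ℕ) (x : ℕ → ℝ) : tstLaw k n x =
    posterior ((n : ℝ) + k - 2) ((minStat x n + truncMax x n) / 2)
      (truncMax x n - minStat x n) := rfl

lemma isProbabilityMeasure_tstLaw {k : ℝ} {n : ℕ} (hn : n0 k ≤ n) (x : ℕ → ℝ) :
    IsProbabilityMeasure (tstLaw k n x) :=
  isProbabilityMeasure_posterior _ (posterior_index_pos hn)
    (truncRange_pos x (by linarith [two_le_n0 k]))

lemma tstLaw_Iio_add_Ici {k : ℝ} {n : ℕ} (hn : n0 k ≤ n) (x : ℕ → ℝ) (y : ℝ) :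
    tstLaw k n x {p | p.2 < y} + tstLaw k n x {p | y ≤ p.2} = 1 := by
  have := isProbabilityMeasure_tstLaw hn x
  rw [← measure_union _ (measurableSet_le_snd y)]
  · convert measure_univ (μ := tstLaw k n x)
    ext p; simp [lt_or_ge]
  · exact disjoint_left.2 fun p h1 h2 => absurd (show y ≤ p.2 from h2) (not_le_of_gt h1)

lemma tstLaw_Iio {k : ℝ} {n : ℕ} (hn : n0 k ≤ n) (x : ℕ → ℝ) {y : ℝ}
    (hy : y ≤ (minStat x n + truncMax x n) / 2) :
    tstLaw k n x {p | p.2 < y} = ENNReal.ofReal (1 / 2 * ((truncMax x n - minStat x n) /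
      (truncMax x n - minStat x n + 2 * ((minStat x n + truncMax x n) / 2 - y))) ^
        ((n : ℝ) + k - 2)) := by
  rw [tstLaw_eq]
  exact posterior_Iio (posterior_index_pos hn) (truncRange_pos x (by linarith [two_le_n0 k])) hy

lemma tstLaw_Ici {k : ℝ} {n : ℕ} (hn : n0 k ≤ n) (x : ℕ → ℝ) {y : ℝ}
    (hy : (minStat x n + truncMax x n) / 2 ≤ y) :
    tstLaw k n x {p | y ≤ p.2} = ENNReal.ofReal (1 / 2 * ((truncMax x n - minStat x n) /
      (truncMax x n - minStat x n + 2 * (y - (minStat x n + truncMax x n) / 2))) ^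
        ((n : ℝ) + k - 2)) := by
  rw [tstLaw_eq]
  exact posterior_Ici (posterior_index_pos hn) (truncRange_pos x (by linarith [two_le_n0 k])) hy

/-- The odds that the sampled mean falls below `y`. -/
noncomputable def odds (k : ℝ) (n : ℕ) (x : ℕ → ℝ) (y : ℝ) : ℝ≥0∞ :=
  tstLaw k n x {p | p.2 < y} / tstLaw k n x {p | y ≤ p.2}

lemma half_le_tstLaw_Ici {k : ℝ} {n : ℕ} (hn : n0 k ≤ n) (x : ℕ → ℝ) {y : ℝ}
    (hy : y ≤ (minStat x n + truncMax x n) / 2) :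
    1 / 2 ≤ tstLaw k n x {p | y ≤ p.2} := by
  have hpos := truncRange_pos x (n := n) (by linarith [two_le_n0 k])
  have hp : tstLaw k n x {p | p.2 < y} ≤ 1 / 2 := by
    rw [tstLaw_Iio hn x hy, show (1 / 2 : ℝ≥0∞) = ENNReal.ofReal (1 / 2) by
      rw [ENNReal.ofReal_div_of_pos two_pos]; simp]
    apply ENNReal.ofReal_le_ofReal
    refine mul_le_of_le_one_right (by norm_num) (Real.rpow_le_one ?_ ?_ (posterior_index_pos hn).le)
    · apply div_nonneg <;> linarith
    · rw [div_le_one (by linarith)]; linarith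
  have hsum := tstLaw_Iio_add_Ici hn x y
  by_contra! hlt
  have hlt' := ENNReal.add_lt_add_of_le_of_lt (hp.trans_lt (by simp)).ne hp hlt
  rw [hsum, one_div, ENNReal.inv_two_add_inv_two] at hlt'
  exact lt_irrefl _ hlt'

lemma tstLaw_Ici_ne_zero {k : ℝ} {n : ℕ} (hn : n0 k ≤ n) (x : ℕ → ℝ) (y : ℝ) :
    tstLaw k n x {p | y ≤ p.2} ≠ 0 := by
  have hpos := truncRange_pos x (n := n) (by linarith [two_le_n0 k])
  rcases le_total y ((minStat x n + truncMax x n) / 2) with hy | hy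
  · exact (lt_of_lt_of_le (by simp) (half_le_tstLaw_Ici hn x hy)).ne'
  · rw [tstLaw_Ici hn x hy]
    have : 0 ≤ y - (minStat x n + truncMax x n) / 2 := sub_nonneg.2 hy
    simp only [ne_eq, ENNReal.ofReal_eq_zero, not_le]
    positivity

lemma odds_mul_tstLaw_Ici {k : ℝ} {n : ℕ} (hn : n0 k ≤ n) (x : ℕ → ℝ) (y : ℝ) :
    odds k n x y * tstLaw k n x {p | y ≤ p.2} = tstLaw k n x {p | p.2 < y} := by
  have := isProbabilityMeasure_tstLaw hn x
  exact ENNReal.div_mul_cancel (tstLaw_Ici_ne_zero hn x y) (measure_ne_top _ _)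

lemma odds_le_of_le {k : ℝ} {n : ℕ} (hn : n0 k ≤ n) (x : ℕ → ℝ) {y : ℝ}
    (hy : y ≤ (minStat x n + truncMax x n) / 2) :
    odds k n x y ≤ ENNReal.ofReal (((truncMax x n - minStat x n) /
      (truncMax x n - minStat x n + 2 * ((minStat x n + truncMax x n) / 2 - y))) ^
        ((n : ℝ) + k - 2)) := by
  rw [odds]
  refine (ENNReal.div_le_div_left (half_le_tstLaw_Ici hn x hy) _).trans ?_
  rw [tstLaw_Iio hn x hy, ENNReal.ofReal_mul (by norm_num), ENNReal.ofReal_div_of_pos two_pos]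
  simp only [ENNReal.ofReal_one, ENNReal.ofReal_ofNat, one_div]
  rw [mul_comm, ENNReal.mul_div_cancel_right (by simp) (by simp)]

/-- The numerator is at most `1`. In the exact denominator, truncated range plus twice the distance
to the midpoint is `2 * (y - minStat x n)`, so the maximum survives only in the truncated range. -/
lemma odds_le_of_ge {k : ℝ} {n : ℕ} (hn : n0 k ≤ n) (x : ℕ → ℝ) {y : ℝ}
    (hy : (minStat x n + truncMax x n) / 2 ≤ y) :
    odds k n x y ≤ 2 * ENNReal.ofReal ((2 * (y - minStat x n) /
      (truncMax x n - minStat x n)) ^ ((n : ℝ) + k - 2)) := by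
  have hpos := truncRange_pos x (n := n) (by linarith [two_le_n0 k])
  have := isProbabilityMeasure_tstLaw hn x
  have hw : 0 < 2 * (y - minStat x n) := by linarith
  rw [odds]
  refine (ENNReal.div_le_div_right prob_le_one _).trans_eq ?_
  rw [tstLaw_Ici hn x hy, one_div, ← ENNReal.ofReal_inv_of_pos]
  · rw [show (2 : ℝ≥0∞) = ENNReal.ofReal 2 by simp, ← ENNReal.ofReal_mul (by norm_num)]
    congr 1
    rw [show truncMax x n - minStat x n + 2 * (y - (minStat x n + truncMax x n) / 2) =
      2 * (y - minStat x n) by ring, mul_inv, one_div, inv_inv, ← Real.inv_rpow (by positivity),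
      inv_div]
  · have : 0 ≤ y - (minStat x n + truncMax x n) / 2 := sub_nonneg.2 hy
    positivity

/-- Three cases, one per summand: a good maximum puts the midpoint well above `m - e` and the odds
decay geometrically; with a bad maximum but the midpoint still above, the odds are at most `1`; a
midpoint below `m - e` gives the excess ratio. -/
lemma odds_le {k : ℝ} {n : ℕ} (hn : n0 k ≤ n) {x : ℕ → ℝ} {m σ e : ℝ} (hσ : 0 < σ) (he : 0 < e)
    (hx : ∀ s, x s ∈ Icc (m - σ / 2) (m + σ / 2)) :
    odds k n x (m - e) ≤
      ENNReal.ofReal ((1 + e / (σ + e)) ^ (-((n : ℝ) + k - 2))) +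
      {x : ℕ → ℝ | maxStat x n < m + σ / 2 - e}.indicator (fun _ => 1) x +
      2 * excessRatio n ((n : ℝ) + k - 2) (m - e) (minStat x n, maxStat x n) := by
  have hn' : 0 < n := by linarith [two_le_n0 k]
  have hpos := truncRange_pos x hn'
  have hq := posterior_index_pos hn
  rcases le_or_gt (m - e) ((minStat x n + truncMax x n) / 2) with hy | hy
  · refine le_add_right ((odds_le_of_le hn x hy).trans ?_)
    set b := truncMax x n - minStat x n with hb
    set D := b + 2 * ((minStat x n + truncMax x n) / 2 - (m - e)) with hD
    have hDb : b ≤ D := by linarith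
    rcases lt_or_ge (maxStat x n) (m + σ / 2 - e) with hmax | hmax
    · refine le_add_left ?_
      rw [indicator_of_mem (show x ∈ {x : ℕ → ℝ | maxStat x n < m + σ / 2 - e} from hmax),
        ← ENNReal.ofReal_one]
      apply ENNReal.ofReal_le_ofReal
      apply Real.rpow_le_one _ _ hq.le
      · apply div_nonneg <;> linarith
      · rw [div_le_one (by linarith)]; exact hDb
    · refine le_add_right (ENNReal.ofReal_le_ofReal ?_)
      rw [Real.rpow_neg (by positivity), ← Real.inv_rpow (by positivity)]
      apply Real.rpow_le_rpow (div_nonneg hpos.le (by linarith)) _ hq.le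
      have hmin : m - σ / 2 ≤ minStat x n := by
        obtain ⟨s, -, hs⟩ := exists_minStat x hn'
        exact hs ▸ (hx s).1
      have hmax' : maxStat x n ≤ m + σ / 2 := by
        obtain ⟨s, -, hs⟩ := exists_maxStat x hn'
        exact hs ▸ (hx s).2
      have hbr : maxStat x n - minStat x n ≤ b := by
        rw [hb, truncMax_sub_minStat]; exact le_max_right _ _
      -- The rate is `e / (σ + e)` and not `e / σ` because the truncated range `b` may exceed `σ`
      -- when `1/n` does. The estimate `key` then needs a rate `c` with both `c ≤ 1` and `c * σ ≤
      -- e`.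
      have hc1 : e / (σ + e) ≤ 1 := by rw [div_le_one (by positivity)]; linarith
      have hcσ : e / (σ + e) * σ ≤ e := by
        rw [div_mul_eq_mul_div, div_le_iff₀ (by positivity)]; nlinarith
      have hc0 : 0 < e / (σ + e) := by positivity
      have key : b * (1 + e / (σ + e)) ≤ D := by
        have h1 : (1 - e / (σ + e)) * (maxStat x n - minStat x n) ≤ (1 - e / (σ + e)) * b :=
          mul_le_mul_of_nonneg_left hbr (by linarith)
        have h2 : e / (σ + e) * (maxStat x n - minStat x n) ≤ e / (σ + e) * σ :=
          mul_le_mul_of_nonneg_left (by linarith) hc0.le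
        have h3 : D = 2 * b - 2 * (m - e - minStat x n) := by rw [hD, hb]; ring
        nlinarith
      rw [div_le_iff₀ (by linarith), ← div_eq_inv_mul, le_div_iff₀ (by positivity)]
      exact key
  · refine le_add_left ((odds_le_of_ge hn x hy.le).trans ?_)
    have hcond : minStat x n ≤ maxStat x n ∧
        max (1 / (n : ℝ)) (maxStat x n - minStat x n) < 2 * (m - e - minStat x n) := by
      refine ⟨minStat_le_maxStat x hn', ?_⟩
      rw [← truncMax_sub_minStat]
      linarith
    rw [excessRatio, if_pos hcond, ← truncMax_sub_minStat]

end Odds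

/-! ### Summing the expected odds over the sample size. -/

section ExpectedOdds

lemma sum_exp_neg_le {y : ℝ} (hy : 0 < y) {a : ℕ} (ha : 1 ≤ a) (T : ℕ) :
    ∑ n ∈ Finset.Ico a T, Real.exp (-(y * n)) ≤ 1 / y := by
  have h1 : ∀ n : ℕ, Real.exp (-(y * n)) = Real.exp (-y) ^ n := fun n => by
    rw [← Real.exp_nat_mul]; ring_nf
  simp_rw [h1]
  have hlt : Real.exp (-y) < 1 := by rw [Real.exp_lt_one_iff]; linarith
  refine (geom_sum_Ico_le_of_lt_one (Real.exp_pos _).le hlt).trans ?_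
  have h2 : Real.exp (-y) ^ a ≤ Real.exp (-y) := pow_le_of_le_one (Real.exp_pos _).le hlt.le (by omega)
  refine (div_le_div_of_nonneg_right h2 (by linarith)).trans ?_
  rw [div_le_div_iff₀ (by linarith) hy]
  have h3 := Real.add_one_le_exp y
  have h4 : Real.exp (-y) * Real.exp y = 1 := by rw [← Real.exp_add]; simp
  nlinarith [Real.exp_pos (-y)]

lemma rpow_le_mul_exp {t κ : ℝ} (ht : 0 ≤ t) (hκ : 0 < κ) : t ^ κ ≤ κ ^ κ * Real.exp t := by
  have h1 : t / κ ≤ Real.exp (t / κ) := by linarith [Real.add_one_le_exp (t / κ)]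
  have h2 := Real.rpow_le_rpow (by positivity) h1 hκ.le
  rw [← Real.exp_mul, div_mul_cancel₀ _ hκ.ne', Real.div_rpow ht hκ.le,
    div_le_iff₀ (by positivity)] at h2
  linarith

/-- Since `max (1 - x) 0 ^ n ≤ exp (-x * n)`, half of the exponent absorbs `n ^ κ` and the other
half gives a geometric sum of size at most `2 / x`. -/
lemma sum_rpow_mul_pow_le {x κ : ℝ} (hx : 0 < x) (hκ : 0 < κ) {a : ℕ} (ha : 1 ≤ a) (T : ℕ) :
    ∑ n ∈ Finset.Ico a T, (n : ℝ) ^ κ * max (1 - x) 0 ^ n ≤ 2 * (2 * κ) ^ κ / x ^ (κ + 1) := by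
  have hr : max (1 - x) 0 ≤ Real.exp (-x) :=
    max_le (by linarith [Real.add_one_le_exp (-x)]) (Real.exp_pos _).le
  have hterm : ∀ n : ℕ, (n : ℝ) ^ κ * max (1 - x) 0 ^ n ≤
      (2 * κ / x) ^ κ * Real.exp (-(x / 2 * n)) := by
    intro n
    have h1 : max (1 - x) 0 ^ n ≤ Real.exp (-(x * n)) := by
      refine (pow_le_pow_left₀ (le_max_right _ _) hr n).trans_eq ?_
      rw [← Real.exp_nat_mul]; ring_nf
    have h2 := rpow_le_mul_exp (t := x * n / 2) (by positivity) hκ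
    have h3 : (n : ℝ) ^ κ ≤ (2 * κ / x) ^ κ * Real.exp (x * n / 2) := by
      have h4 : (n : ℝ) = 2 / x * (x * n / 2) := by field_simp
      have h5 : 2 * κ / x = 2 / x * κ := by ring
      rw [h5, Real.mul_rpow (by positivity) hκ.le]
      nth_rewrite 1 [h4]
      rw [Real.mul_rpow (by positivity) (by positivity), mul_assoc]
      gcongr
    calc _ ≤ (2 * κ / x) ^ κ * Real.exp (x * n / 2) * Real.exp (-(x * n)) := by gcongr
      _ = _ := by rw [mul_assoc, ← Real.exp_add]; ring_nf
  refine (Finset.sum_le_sum fun n _ => hterm n).trans ?_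
  rw [← Finset.mul_sum]
  refine (mul_le_mul_of_nonneg_left (sum_exp_neg_le (by positivity : 0 < x / 2) ha T)
    (by positivity)).trans_eq ?_
  rw [Real.div_rpow (by positivity) hx.le, Real.rpow_add_one hx.ne']
  field_simp

lemma sum_mul_pow_le {x : ℝ} (hx : 0 < x) {a : ℕ} (ha : 1 ≤ a) (T : ℕ) :
    ∑ n ∈ Finset.Ico a T, (n : ℝ) * max (1 - x) 0 ^ n ≤ 1 / x ^ 2 := by
  rcases le_or_gt 1 x with h | h
  · rw [max_eq_right (by linarith), Finset.sum_eq_zero]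
    · positivity
    · intro n hn
      rw [zero_pow (by have := (Finset.mem_Ico.1 hn).1; omega), mul_zero]
  · rw [max_eq_left (by linarith)]
    have hs := hasSum_coe_mul_geometric_of_norm_lt_one (𝕜 := ℝ) (r := 1 - x)
      (by rw [Real.norm_eq_abs, abs_of_pos (by linarith)]; linarith)
    refine (sum_le_hasSum _ (fun n _ => ?_) hs).trans ?_
    · have : 0 ≤ 1 - x := by linarith
      positivity
    · rw [sub_sub_cancel]
      gcongr
      linarith

/-- Bound for the part of the odds of the optimal arm that is due to overestimated means. -/
noncomputable def excessConst (ε k σ : ℝ) : ℝ :=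
  if k < 1 then 1 / (1 - k) * (σ ^ 2 / (9 * ε ^ 2))
  else if k = 1 then (33 + Real.log (1 + σ ^ 2 / (3 * ε))) * (σ ^ 2 / (9 * ε ^ 2))
  else k / (k - 1) * (2 * (2 * k) ^ k) * (σ ^ (2 * k) / (3 * ε) ^ (k + 1))

variable {Ω : Type*} [MeasurableSpace Ω] {P : Measure Ω} {Y : ℕ → Ω → ℝ} {m σ : ℝ}

/-- Bookkeeping common to the three regimes: at `c = m - 3 * ε / 2` the upper limit for `w` is `σ *
max (1 - 3 * ε / σ) 0`, and the factor `2` of the odds cancels the one in `2 * (M + 1)`. -/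
lemma sum_excessRatio_aux {k ε : ℝ} (hσ : 0 < σ) {J M B : ℕ → ℝ} {T : ℕ}
    (hJM : ∀ n, n0 k ≤ n → ∫⁻ ω, excessRatio n ((n : ℝ) + k - 2) (m - 3 * ε / 2)
      (minStat (fun s => Y s ω) n, maxStat (fun s => Y s ω) n) ∂P ≤
      ENNReal.ofReal (n * (n - 1) / σ ^ n *
        (J n * (max (2 * (m - 3 * ε / 2 - (m - σ / 2))) 0 ^ (M n + 1) / (2 * (M n + 1))))))
    (hB0 : ∀ n, n0 k ≤ n → 0 ≤ B n)
    (hB : ∀ n, n0 k ≤ n → n * (n - 1) / σ ^ n *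
        (J n * ((σ * max (1 - 3 * ε / σ) 0) ^ (M n + 1) / (M n + 1))) ≤ B n)
    {E : ℝ} (hE : ∑ n ∈ Finset.Ico (n0 k) T, B n ≤ E) :
    ∑ n ∈ Finset.Ico (n0 k) T, 2 * ∫⁻ ω, excessRatio n ((n : ℝ) + k - 2) (m - 3 * ε / 2)
      (minStat (fun s => Y s ω) n, maxStat (fun s => Y s ω) n) ∂P ≤ ENNReal.ofReal E := by
  have hR : max (2 * (m - 3 * ε / 2 - (m - σ / 2))) 0 = σ * max (1 - 3 * ε / σ) 0 := by
    rw [mul_max_of_nonneg _ _ hσ.le, mul_zero]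
    congr 1
    field_simp
    ring
  refine le_trans ?_ (ENNReal.ofReal_le_ofReal hE)
  rw [ENNReal.ofReal_sum_of_nonneg fun n hn => hB0 n (Finset.mem_Ico.1 hn).1]
  refine Finset.sum_le_sum fun n hn => ?_
  have hn' := (Finset.mem_Ico.1 hn).1
  refine (mul_le_mul_right (hJM n hn') 2).trans ?_
  rw [show (2 : ℝ≥0∞) = ENNReal.ofReal 2 by simp, ← ENNReal.ofReal_mul (by norm_num)]
  refine ENNReal.ofReal_le_ofReal (le_trans (le_of_eq ?_) (hB n hn'))
  rw [hR, mul_comm (2 : ℝ) (M n + 1), ← div_div]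
  ring

lemma sum_excessRatio_le [IsProbabilityMeasure P] (hY : ∀ s, Measurable (Y s))
    (hlaw : ∀ s, P.map (Y s) = uniLaw m σ) (hind : iIndepFun Y P) (hσ : 0 < σ)
    {ε : ℝ} (hε : 0 < ε) (k : ℝ) (T : ℕ) :
    ∑ n ∈ Finset.Ico (n0 k) T, 2 * ∫⁻ ω, excessRatio n ((n : ℝ) + k - 2) (m - 3 * ε / 2)
      (minStat (fun s => Y s ω) n, maxStat (fun s => Y s ω) n) ∂P ≤
      ENNReal.ofReal (excessConst ε k σ) := by
  have hc : 2 * (m - 3 * ε / 2 - (m - σ / 2)) ≤ σ := by linarith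
  have hx : 0 < 3 * ε / σ := by positivity
  have hn0 : 1 ≤ n0 k := by linarith [two_le_n0 k]
  set x := 3 * ε / σ with hxdef
  have hx2 : 1 / x ^ 2 = σ ^ 2 / (9 * ε ^ 2) := by rw [hxdef]; field_simp; ring
  set r := max (1 - x) 0 with hr
  have hr0 : 0 ≤ r := le_max_right _ _
  have hr1 : r ≤ 1 := max_le (by linarith) zero_le_one
  have hn2 : ∀ {n : ℕ}, n0 k ≤ n → 2 ≤ n := fun h => (two_le_n0 k).trans h
  have hn2' : ∀ {n : ℕ}, n0 k ≤ n → (2 : ℝ) ≤ n := fun h => by exact_mod_cast hn2 h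
  have hpow : ∀ n : ℕ, (σ * r) ^ ((n : ℝ) - 1 + 1) = σ ^ n * r ^ n := fun n => by
    rw [sub_add_cancel, Real.rpow_natCast, mul_pow]
  rcases lt_trichotomy k 1 with hk | hk | hk
  · rw [excessConst, if_pos hk]
    have hk' : 0 < 1 - k := by linarith
    refine sum_excessRatio_aux hσ (J := fun _ => 1 / (1 - k)) (M := fun n => (n : ℝ) - 1)
      (B := fun n => 1 / (1 - k) * (n * r ^ n)) (fun n hn => ?_) (fun n _ => by positivity)
      (fun n hn => ?_) ?_
    · exact lintegral_excessRatio_le hY hlaw hind hσ (hn2 hn) (by positivity)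
        (by linarith [hn2' hn]) hc fun w hw _ =>
          lintegral_truncated_of_lt_one (hn2 hn) hk (posterior_index_pos hn) hw
    · rw [hpow, sub_add_cancel]
      have := hn2' hn
      rw [show (n : ℝ) * (n - 1) / σ ^ n * (1 / (1 - k) * (σ ^ n * r ^ n / n)) =
        1 / (1 - k) * ((n - 1) * r ^ n) by field_simp]
      gcongr
      linarith
    · rw [← Finset.mul_sum, ← hx2]
      exact mul_le_mul_of_nonneg_left (sum_mul_pow_le hx hn0 T) (by positivity)
  · subst hk
    rw [excessConst, if_neg (lt_irrefl _), if_pos rfl]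
    set Λ := Real.log (1 + σ ^ 2 / (3 * ε)) with hΛ
    have hΛ0 : 0 ≤ Λ := Real.log_nonneg (by linarith [show 0 ≤ σ ^ 2 / (3 * ε) by positivity])
    -- This splits the logarithm into a part free of `n` and one linear in `n * x`. The linear part
    -- meets `n * r ^ n`, and its sum is at most `32 / x ^ 2`, which with the leading `1` makes the
    -- `33` in `excessConst`.
    have hlog : ∀ n : ℕ, Real.log (1 + n * σ) ≤ Λ + n * x := by
      intro n
      have h1 : 1 + n * σ ≤ (1 + σ ^ 2 / (3 * ε)) * (1 + n * x) := by
        have : (1 + σ ^ 2 / (3 * ε)) * (1 + n * x) = 1 + n * σ + σ ^ 2 / (3 * ε) + n * x := by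
          rw [hxdef]; field_simp; ring
        rw [this]
        linarith [show 0 ≤ σ ^ 2 / (3 * ε) by positivity, show 0 ≤ n * x by positivity]
      refine (Real.log_le_log (by positivity) h1).trans ?_
      rw [Real.log_mul (by positivity) (by positivity)]
      have : 0 < 1 + n * x := by positivity
      linarith [Real.log_le_sub_one_of_pos this]
    refine sum_excessRatio_aux hσ (J := fun n => 1 + Real.log (1 + n * σ))
      (M := fun n => (n : ℝ) - 1)
      (B := fun n => (1 + Λ) * (n * r ^ n) + x * ((n : ℝ) ^ (2 : ℝ) * r ^ n)) (fun n hn => ?_)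
      (fun n _ => by positivity) (fun n hn => ?_) ?_
    · have h0 : 0 ≤ Real.log (1 + n * σ) :=
        Real.log_nonneg (by linarith [show 0 ≤ n * σ by positivity])
      exact lintegral_excessRatio_le hY hlaw hind hσ (hn2 hn) (by positivity)
        (by linarith [hn2' hn]) hc fun w hw hwσ =>
          lintegral_truncated_of_eq_one (hn2 hn) hw hwσ
    · rw [hpow, sub_add_cancel]
      have hn' := hn2' hn
      rw [show (n : ℝ) * (n - 1) / σ ^ n * ((1 + Real.log (1 + n * σ)) * (σ ^ n * r ^ n / n)) =
        (1 + Real.log (1 + n * σ)) * ((n - 1) * r ^ n) by field_simp]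
      have hn1 : (0 : ℝ) ≤ n - 1 := by linarith
      have hle : (n : ℝ) - 1 ≤ n := by linarith
      calc _ ≤ (1 + (Λ + n * x)) * (n * r ^ n) := by
            gcongr
            exact hlog n
        _ = _ := by rw [Real.rpow_two]; ring
    · rw [Finset.sum_add_distrib, ← Finset.mul_sum, ← Finset.mul_sum]
      have h1 := sum_mul_pow_le hx hn0 T
      have h2 := sum_rpow_mul_pow_le hx (κ := 2) two_pos hn0 T
      have h3 : x * (2 * (2 * 2 : ℝ) ^ (2 : ℝ) / x ^ ((2 : ℝ) + 1)) = 32 * (1 / x ^ 2) := by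
        rw [Real.rpow_add_one hx.ne', Real.rpow_two, Real.rpow_two]
        field_simp
        norm_num
      calc _ ≤ (1 + Λ) * (1 / x ^ 2) + 32 * (1 / x ^ 2) := by
            rw [← h3]
            gcongr
        _ = _ := by rw [← hx2]; ring
  · rw [excessConst, if_neg (by linarith), if_neg (by linarith)]
    have hk' : 0 < k - 1 := by linarith
    refine sum_excessRatio_aux hσ (J := fun n => k / (k - 1) * (n : ℝ) ^ (k - 1))
      (M := fun n => (n : ℝ) + k - 2)
      (B := fun n => k / (k - 1) * σ ^ (k - 1) * ((n : ℝ) ^ k * r ^ n)) (fun n hn => ?_)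
      (fun n _ => by positivity) (fun n hn => ?_) ?_
    · exact lintegral_excessRatio_le hY hlaw hind hσ (hn2 hn) (by positivity)
        (by linarith [hn2' hn]) hc fun w hw _ =>
          lintegral_truncated_of_one_lt (hn2 hn) hk hw
    · have hn' := hn2' hn
      -- The surplus factor `r ^ (k - 1) ≤ 1` is dropped. The surplus `σ ^ (k - 1)` stays and, with
      -- `(σ / (3 * ε)) ^ (k + 1)` from the sum, yields `σ ^ (2 * k)`.
      have hpow' : (σ * r) ^ ((n : ℝ) + k - 2 + 1) ≤ σ ^ n * σ ^ (k - 1) * r ^ n := by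
        rw [show (n : ℝ) + k - 2 + 1 = n + (k - 1) by ring, Real.mul_rpow hσ.le hr0,
          Real.rpow_add hσ, Real.rpow_natCast]
        gcongr
        rw [Real.rpow_add' hr0 (by linarith), Real.rpow_natCast]
        exact mul_le_of_le_one_right (by positivity) (Real.rpow_le_one hr0 hr1 hk'.le)
      have hq : (n : ℝ) - 1 ≤ (n : ℝ) + k - 2 + 1 := by linarith
      have hq0 : 0 < (n : ℝ) + k - 2 + 1 := by linarith
      have hnk : (n : ℝ) ^ k = n * (n : ℝ) ^ (k - 1) := by
        rw [Real.rpow_sub_one (by positivity)]; field_simp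
      calc _ ≤ n * (n - 1) / σ ^ n * (k / (k - 1) * (n : ℝ) ^ (k - 1) *
            (σ ^ n * σ ^ (k - 1) * r ^ n / ((n : ℝ) + k - 2 + 1))) := by
            have : (0 : ℝ) ≤ n - 1 := by linarith
            gcongr
        _ = (n - 1) / ((n : ℝ) + k - 2 + 1) *
            (k / (k - 1) * σ ^ (k - 1) * ((n : ℝ) ^ k * r ^ n)) := by
            rw [hnk]; field_simp
        _ ≤ _ := by
            apply mul_le_of_le_one_left (by positivity)
            rw [div_le_one hq0]
            exact hq
    · rw [← Finset.mul_sum]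
      have hκ : 0 < k := by linarith
      refine (mul_le_mul_of_nonneg_left (sum_rpow_mul_pow_le hx hκ hn0 T)
        (by positivity)).trans_eq ?_
      have h2k : σ ^ (2 * k) = σ ^ (k - 1) * σ ^ (k + 1) := by
        rw [← Real.rpow_add hσ]; ring_nf
      rw [hxdef, Real.div_rpow (by positivity) hσ.le, h2k]
      have := Real.rpow_pos_of_pos hσ (k + 1)
      have := Real.rpow_pos_of_pos (by positivity : 0 < 3 * ε) (k + 1)
      field_simp

lemma excessConst_nonneg {ε k σ : ℝ} (hε : 0 < ε) (hσ : 0 < σ) : 0 ≤ excessConst ε k σ := by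
  unfold excessConst
  split_ifs with h1 h2
  · have : 0 < 1 - k := by linarith
    positivity
  · have : 0 ≤ Real.log (1 + σ ^ 2 / (3 * ε)) :=
      Real.log_nonneg (by linarith [show 0 ≤ σ ^ 2 / (3 * ε) by positivity])
    positivity
  · have : 0 < k - 1 := by
      have := lt_of_le_of_ne (not_lt.1 h1) (Ne.symm h2)
      linarith
    have : 0 < k := by linarith
    positivity

lemma sum_pow_ofReal_le {q : ℝ} (hq : 0 < q) {a : ℕ} (ha : 1 ≤ a) (T : ℕ) :
    ∑ n ∈ Finset.Ico a T, ENNReal.ofReal (1 - q) ^ n ≤ ENNReal.ofReal (1 / q) := by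
  rcases le_or_gt 1 q with h | h
  · rw [Finset.sum_eq_zero]
    · exact zero_le
    · intro n hn
      rw [ENNReal.ofReal_of_nonpos (by linarith),
        zero_pow (by have := (Finset.mem_Ico.1 hn).1; omega)]
  · have h0 : 0 ≤ 1 - q := by linarith
    simp_rw [← ENNReal.ofReal_pow h0]
    rw [← ENNReal.ofReal_sum_of_nonneg fun n _ => by positivity]
    apply ENNReal.ofReal_le_ofReal
    refine (geom_sum_Ico_le_of_lt_one h0 (by linarith)).trans ?_
    rw [sub_sub_cancel]
    gcongr
    exact pow_le_one₀ h0 (by linarith)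

/-- The index `n + k - 2` exceeds `n - n0 k`, so the sum is dominated by a geometric series starting
at `1`, whatever `k` is. -/
lemma sum_rpow_neg_index_le {c : ℝ} (hc : 0 < c) (k : ℝ) (T : ℕ) :
    ∑ n ∈ Finset.Ico (n0 k) T, ENNReal.ofReal ((1 + c) ^ (-((n : ℝ) + k - 2))) ≤
      ENNReal.ofReal (1 + 1 / c) := by
  have hc1 : (1 + c)⁻¹ < 1 := inv_lt_one_of_one_lt₀ (by linarith)
  have hterm : ∀ n ∈ Finset.Ico (n0 k) T, (1 + c) ^ (-((n : ℝ) + k - 2)) ≤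
      (1 + c)⁻¹ ^ (n - n0 k) := by
    intro n hn
    have hn' := (Finset.mem_Ico.1 hn).1
    rw [inv_pow, ← Real.rpow_natCast, ← Real.rpow_neg (by positivity), Nat.cast_sub hn']
    exact Real.rpow_le_rpow_of_exponent_le (by linarith) (by linarith [sub_n0_lt (k := k) n])
  rw [← ENNReal.ofReal_sum_of_nonneg fun n _ => by positivity]
  apply ENNReal.ofReal_le_ofReal
  refine (Finset.sum_le_sum hterm).trans ?_
  rw [Finset.sum_Ico_eq_sum_range]
  simp_rw [Nat.add_sub_cancel_left]
  rw [← Nat.Ico_zero_eq_range]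
  refine (geom_sum_Ico_le_of_lt_one (by positivity) hc1).trans_eq ?_
  rw [pow_zero]
  have : 1 - (1 + c)⁻¹ = c / (1 + c) := by field_simp; ring
  rw [this]
  field_simp
  ring

lemma sum_lintegral_odds_le [IsProbabilityMeasure P] (hY : ∀ s, Measurable (Y s))
    (hlaw : ∀ s, P.map (Y s) = uniLaw m σ) (hind : iIndepFun Y P) (hσ : 0 < σ)
    {ε : ℝ} (hε : 0 < ε) (k : ℝ) (T : ℕ) :
    ∑ n ∈ Finset.Ico (n0 k) T, ∫⁻ ω, odds k n (fun s => Y s ω) (m - 3 * ε / 2) ∂P ≤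
      ENNReal.ofReal (2 + 4 / 3 * (σ / ε) + excessConst ε k σ) := by
  set e := 3 * ε / 2 with he
  have he0 : 0 < e := by positivity
  have hterm : ∀ n ∈ Finset.Ico (n0 k) T, ∫⁻ ω, odds k n (fun s => Y s ω) (m - e) ∂P ≤
      ENNReal.ofReal ((1 + e / (σ + e)) ^ (-((n : ℝ) + k - 2))) +
      ENNReal.ofReal (1 - e / σ) ^ n + 2 * ∫⁻ ω, excessRatio n ((n : ℝ) + k - 2) (m - e)
        (minStat (fun s => Y s ω) n, maxStat (fun s => Y s ω) n) ∂P := by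
    intro n hn
    have hmax := measurable_maxStat hY n
    have hset : MeasurableSet {ω | maxStat (fun s => Y s ω) n < m + σ / 2 - e} :=
      measurableSet_lt hmax measurable_const
    have hexc : Measurable fun ω => excessRatio n ((n : ℝ) + k - 2) (m - e)
        (minStat (fun s => Y s ω) n, maxStat (fun s => Y s ω) n) :=
      (measurable_excessRatio _ _ _).comp ((measurable_minStat hY n).prodMk hmax)
    calc _ ≤ ∫⁻ ω, (ENNReal.ofReal ((1 + e / (σ + e)) ^ (-((n : ℝ) + k - 2))) +
          {ω | maxStat (fun s => Y s ω) n < m + σ / 2 - e}.indicator (fun _ => 1) ω) +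
          2 * excessRatio n ((n : ℝ) + k - 2) (m - e)
            (minStat (fun s => Y s ω) n, maxStat (fun s => Y s ω) n) ∂P := by
          refine lintegral_mono_ae ?_
          filter_upwards [ae_mem_support hY hlaw] with ω hω
          exact odds_le (Finset.mem_Ico.1 hn).1 hσ he0 hω
      _ ≤ _ := by
          rw [lintegral_add_right _ (hexc.const_mul 2), lintegral_const_mul _ hexc,
            lintegral_add_left measurable_const, lintegral_const, measure_univ, mul_one,
            lintegral_indicator_const hset, one_mul]
          gcongr
          exact measure_maxStat_lt hY hlaw hind hσ e n
  refine (Finset.sum_le_sum hterm).trans ?_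
  rw [Finset.sum_add_distrib, Finset.sum_add_distrib]
  have h1 := sum_rpow_neg_index_le (c := e / (σ + e)) (by positivity) k T
  have h2 := sum_pow_ofReal_le (q := e / σ) (by positivity) (by linarith [two_le_n0 k]) T
  have h3 := sum_excessRatio_le hY hlaw hind hσ hε k T
  refine (add_le_add (add_le_add h1 h2) h3).trans_eq ?_
  rw [← ENNReal.ofReal_add (by positivity) (by positivity),
    ← ENNReal.ofReal_add (by positivity) (excessConst_nonneg hε hσ)]
  congr 2
  rw [he]
  field_simp
  ring

/-- The term of the regret bound that depends on the optimal arm only. -/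
noncomputable def optConst (ε k σ : ℝ) : ℝ :=
  if k < 1 then 1 + 9 * σ / ε + 3 / 16 * max 1 (1 / (1 - k)) * (σ ^ 2 / ε ^ 2) *
    (2 * Real.exp (2 * ε / σ) - 1)
  else 2 + 4 / 3 * (σ / ε) + excessConst ε k σ

/-- Only `k < 1` needs an argument: the derived constant must be compared with the prescribed
exponential expression. -/
lemma le_optConst {ε k σ : ℝ} (hε : 0 < ε) (hσ : 0 < σ) :
    2 + 4 / 3 * (σ / ε) + excessConst ε k σ ≤ optConst ε k σ := by
  unfold optConst
  split_ifs with hk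
  · rw [excessConst, if_pos hk]
    have hk' : 0 < 1 - k := by linarith
    set M := max 1 (1 / (1 - k)) with hM
    have hM1 : 1 ≤ M := le_max_left _ _
    have hM2 : 1 / (1 - k) ≤ M := le_max_right _ _
    set u := σ / ε with hu
    have hu0 : 0 < u := by positivity
    -- The cubic term is needed for small `u`: the lower ones leave the constant `7/4` against the
    -- required `2`, and the cubic one supplies a multiple of `u⁻¹`.
    have hexp : 1 + 2 / u + 2 / u ^ 2 + 4 / (3 * u ^ 3) ≤ Real.exp (2 * ε / σ) := by
      have h := Real.sum_le_exp_of_nonneg (x := 2 * ε / σ) (by positivity) 4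
      refine le_trans (le_of_eq ?_) h
      rw [show 2 * ε / σ = 2 / u by rw [hu]; field_simp]
      simp only [Finset.sum_range_succ, Finset.sum_range_zero, Nat.factorial]
      field_simp
      norm_num
      ring
    have h1 : σ ^ 2 / (9 * ε ^ 2) = u ^ 2 / 9 := by rw [hu]; field_simp
    have h2 : σ ^ 2 / ε ^ 2 = u ^ 2 := by rw [hu]; field_simp
    have h3 : 9 * σ / ε = 9 * u := by rw [hu]; ring
    rw [h1, h2, h3]
    have h4 : u ^ 2 + 4 * u + 4 + 8 / 3 * u⁻¹ ≤ u ^ 2 * (2 * Real.exp (2 * ε / σ) - 1) := by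
      have : u ^ 2 * (2 * (1 + 2 / u + 2 / u ^ 2 + 4 / (3 * u ^ 3)) - 1) =
          u ^ 2 + 4 * u + 4 + 8 / 3 * u⁻¹ := by
        field_simp; ring
      rw [← this]
      gcongr
    have h5 : 1 / (1 - k) * (u ^ 2 / 9) ≤ M * (u ^ 2 / 9) := by gcongr
    have h6 : 3 / 16 * M * (u ^ 2 + 4 * u + 4 + 8 / 3 * u⁻¹) ≤
        3 / 16 * M * (u ^ 2 * (2 * Real.exp (2 * ε / σ) - 1)) := by gcongr
    have hv : u * u⁻¹ = 1 := mul_inv_cancel₀ hu0.ne'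
    have hv0 : 0 < u⁻¹ := by positivity
    have h7 : 4 * u + 4 + 8 / 3 * u⁻¹ ≤ M * (4 * u + 4 + 8 / 3 * u⁻¹) :=
      le_mul_of_one_le_left (by positivity) hM1
    have h8 : 0 ≤ M * u ^ 2 := by positivity
    have h9 : 1 ≤ u + u⁻¹ := by nlinarith [sq_nonneg (u - u⁻¹)]
    linarith
  · exact le_rfl

end ExpectedOdds

/-! ### From rounds of the algorithm to sample sizes. -/

section Dynamics

lemma measurable_posterior_apply (m : ℝ) {S : Set (ℝ × ℝ)} (hS : MeasurableSet S) :
    Measurable fun q : ℝ × ℝ => posterior m q.1 q.2 S := by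
  have hmeas : Measurable fun r : (ℝ × ℝ) × (ℝ × ℝ) =>
      ENNReal.ofReal (posteriorDensity m r.1.1 r.1.2 r.2) := by
    unfold posteriorDensity scaleDensity uniDensity
    have h1 : Measurable fun r : (ℝ × ℝ) × (ℝ × ℝ) => r.1.2 := by fun_prop
    have h2 : Measurable fun r : (ℝ × ℝ) × (ℝ × ℝ) => r.2.1 := by fun_prop
    have h3 : Measurable fun r : (ℝ × ℝ) × (ℝ × ℝ) => r.2.2 := by fun_prop
    have h4 : Measurable fun r : (ℝ × ℝ) × (ℝ × ℝ) => r.1.1 - (r.2.1 - r.1.2) / 2 := by fun_prop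
    have h5 : Measurable fun r : (ℝ × ℝ) × (ℝ × ℝ) => r.1.1 + (r.2.1 - r.1.2) / 2 := by fun_prop
    refine (Measurable.mul ?_ ?_).ennreal_ofReal
    · refine Measurable.ite (measurableSet_le h1 h2) ?_ measurable_const
      fun_prop
    · refine Measurable.ite ((measurableSet_le h4 h3).inter (measurableSet_le h3 h5)) ?_
        measurable_const
      fun_prop
  simp_rw [posterior, withDensity_apply _ hS]
  exact hmeas.lintegral_prod_right'

lemma measurable_apply_nat {Ω β : Type*} {mΩ : MeasurableSpace Ω} [MeasurableSpace β]
    {F : ℕ → Ω → β} (hF : ∀ n, Measurable (F n)) {N : Ω → ℕ} (hN : Measurable N) :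
    Measurable fun ω => F (N ω) ω := by
  have h : Measurable fun p : ℕ × Ω => F p.1 p.2 := measurable_from_prod_countable_right hF
  exact h.comp (hN.prodMk measurable_id)

lemma measurable_tstLaw {Ω : Type*} {mΩ : MeasurableSpace Ω} {Y : ℕ → Ω → ℝ}
    (hY : ∀ s, Measurable (Y s)) (k : ℝ) (n : ℕ) {S : Set (ℝ × ℝ)} (hS : MeasurableSet S) :
    Measurable fun ω => tstLaw k n (fun s => Y s ω) S := by
  have h1 := measurable_minStat hY n
  have h2 := measurable_maxStat hY n
  have h3 : Measurable fun ω => truncMax (fun s => Y s ω) n := (h1.add_const _).max h2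
  have h4 : Measurable fun ω => ((minStat (fun s => Y s ω) n + truncMax (fun s => Y s ω) n) / 2,
      truncMax (fun s => Y s ω) n - minStat (fun s => Y s ω) n) :=
    ((h1.add h3).div_const 2).prodMk (h3.sub h1)
  simp only [tstLaw_eq]
  have h5 := (measurable_posterior_apply ((n : ℝ) + k - 2) hS).comp h4
  simp only [Function.comp_def] at h5
  exact h5

lemma measurable_odds {Ω : Type*} {mΩ : MeasurableSpace Ω} {Y : ℕ → Ω → ℝ}
    (hY : ∀ s, Measurable (Y s)) (k : ℝ) (n : ℕ) (y : ℝ) :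
    Measurable fun ω => odds k n (fun s => Y s ω) y :=
  (measurable_tstLaw hY k n (measurableSet_snd_lt y)).div
    (measurable_tstLaw hY k n (measurableSet_le_snd y))

section Pulls

variable {Ω : Type*} {K : ℕ} {arm : ℕ → Ω → Fin K}

lemma pulls_succ (i : Fin K) (t : ℕ) (ω : Ω) :
    pulls arm i (t + 1) ω = pulls arm i t ω + if arm t ω = i then 1 else 0 :=
  Finset.sum_range_succ _ _

lemma pulls_mono (i : Fin K) (ω : Ω) : Monotone fun t => pulls arm i t ω :=
  monotone_nat_of_le_succ fun t => by rw [pulls_succ]; exact Nat.le_add_right _ _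

lemma pulls_le (i : Fin K) (t : ℕ) (ω : Ω) : pulls arm i t ω ≤ t := by
  induction t with
  | zero => simp [pulls]
  | succ t ih => rw [pulls_succ]; split_ifs <;> omega

/-- Reindexes the rounds in which an arm is played by the number of its earlier plays; every number
occurs exactly once. -/
lemma sum_ite_arm_eq {M : Type*} [AddCommMonoid M] (i : Fin K) (f : ℕ → M) (ω : Ω) (T : ℕ) :
    ∑ t ∈ Finset.range T, (if arm t ω = i then f (pulls arm i t ω) else 0) =
      ∑ n ∈ Finset.range (pulls arm i T ω), f n := by
  induction T with
  | zero => simp [pulls]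
  | succ T ih =>
    rw [Finset.sum_range_succ, ih, pulls_succ]
    split_ifs
    · rw [Finset.sum_range_succ]
    · simp

variable {X : Fin K → ℕ → Ω → ℝ} {θ : ℕ → Fin K → Ω → ℝ × ℝ}

lemma measurable_past_reward (t : ℕ) (i : Fin K) (s : ℕ) :
    Measurable[past X θ arm t] (X i s) := by
  rw [measurable_iff_comap_le]
  exact le_sup_of_le_left (le_iSup₂_of_le i s le_rfl)

lemma measurable_past_arm {t s : ℕ} (hs : s < t) : Measurable[past X θ arm t] (arm s) := by
  rw [measurable_iff_comap_le]
  exact le_sup_of_le_right (le_iSup₂_of_le s hs le_sup_right)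

lemma measurable_past_pulls (t : ℕ) (i : Fin K) : Measurable[past X θ arm t] (pulls arm i t) := by
  have h : ∀ s ∈ Finset.range t, Measurable[past X θ arm t]
      fun ω => if arm s ω = i then 1 else 0 := fun s hs =>
    Measurable.ite (measurable_past_arm (Finset.mem_range.1 hs) (measurableSet_singleton i))
      measurable_const measurable_const
  exact Finset.measurable_fun_sum _ h

end Pulls

namespace IsTSTRun

variable {Ω : Type*} {K : ℕ} [mΩ : MeasurableSpace Ω] {P : Measure Ω} {μ σ : Fin K → ℝ} {k : ℝ}
  {X : Fin K → ℕ → Ω → ℝ} {θ : ℕ → Fin K → Ω → ℝ × ℝ} {arm : ℕ → Ω → Fin K}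

lemma past_le (h : IsTSTRun P μ σ k X θ arm) (t : ℕ) : past X θ arm t ≤ mΩ := by
  refine sup_le (iSup_le fun i => iSup_le fun s => (h.measurable_reward i s).comap_le)
    (iSup_le fun s => iSup_le fun _ => sup_le (iSup_le fun i => (h.measurable_sample s i).comap_le)
      (h.measurable_arm s).comap_le)

lemma n0_le_pulls (h : IsTSTRun P μ σ k X θ arm) {t : ℕ} (ht : K * n0 k ≤ t) (i : Fin K) (ω : Ω) :
    n0 k ≤ pulls arm i t ω :=
  (h.initial ω i).symm.le.trans (pulls_mono i ω ht)

lemma pulls_lt_n0 (h : IsTSTRun P μ σ k X θ arm) {t : ℕ} (ht : t < K * n0 k) {i : Fin K} {ω : Ω}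
    (hi : arm t ω = i) : pulls arm i t ω < n0 k := by
  have h1 := pulls_mono (arm := arm) i ω (Nat.succ_le_of_lt ht)
  simp only [Nat.succ_eq_add_one, pulls_succ, h.initial, if_pos hi] at h1
  omega

/-- Extends `sample_law` from past events to past-measurable weights: on the past σ-algebra, the
restriction of `P` to the sampling event and the measure with the product density coincide. -/
lemma setLIntegral_samples (h : IsTSTRun P μ σ k X θ arm) {t : ℕ} (ht : K * n0 k ≤ t)
    {B : Fin K → Set (ℝ × ℝ)} (hB : ∀ i, MeasurableSet (B i)) {g : Ω → ℝ≥0∞}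
    (hg : Measurable[past X θ arm t] g) :
    ∫⁻ ω in {ω | ∀ i, θ t i ω ∈ B i}, g ω ∂P =
      ∫⁻ ω, g ω * ∏ i, tstLaw k (pulls arm i t ω) (fun s => X i s ω) (B i) ∂P := by
  have hle := h.past_le t
  set ρ : Ω → ℝ≥0∞ := fun ω => ∏ i, tstLaw k (pulls arm i t ω) (fun s => X i s ω) (B i) with hρ
  have hρm : Measurable ρ := by
    refine Finset.measurable_fun_prod _ fun i _ => ?_
    exact measurable_apply_nat (F := fun n ω => tstLaw k n (fun s => X i s ω) (B i))
      (fun n => measurable_tstLaw (h.measurable_reward i) k n (hB i))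
      ((measurable_past_pulls (X := X) (θ := θ) t i).mono hle le_rfl)
  set D := {ω | ∀ i, θ t i ω ∈ B i} with hD
  have hDm : MeasurableSet D := by
    rw [hD, ofPred_forall]
    exact MeasurableSet.iInter fun i => h.measurable_sample t i (hB i)
  have htrim : (P.restrict D).trim hle = (P.withDensity ρ).trim hle := by
    refine @Measure.ext _ (past X θ arm t) _ _ fun E hE => ?_
    rw [trim_measurableSet_eq hle hE, trim_measurableSet_eq hle hE,
      withDensity_apply _ (hle E hE), Measure.restrict_apply (hle E hE), h.sample_law t ht E hE B hB]
  rw [← lintegral_trim hle hg, htrim, lintegral_trim hle hg,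
    lintegral_withDensity_eq_lintegral_mul _ hρm (hg.mono hle le_rfl)]
  exact lintegral_congr fun ω => mul_comm _ _

/-- The change of measure. Given the past, flipping the condition on the optimal sample from `< y`
to `≥ y` multiplies the probability by the reciprocal of the odds, and the flipped event forces the
optimal arm to be played. The odds may serve as a weight because they are determined by the past. -/
lemma measure_all_lt_le (h : IsTSTRun P μ σ k X θ arm) {t : ℕ} (ht : K * n0 k ≤ t)
    (opt : Fin K) (y : ℝ) :
    P {ω | ∀ i, (θ t i ω).2 < y} ≤
      ∫⁻ ω in {ω | arm t ω = opt}, odds k (pulls arm opt t ω) (fun s => X opt s ω) y ∂P := by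
  set B : Fin K → Set (ℝ × ℝ) := fun i => if i = opt then {p | y ≤ p.2} else {p | p.2 < y} with hB
  have hBm : ∀ i, MeasurableSet (B i) := fun i => by
    simp only [hB]
    split_ifs
    · exact measurableSet_le_snd y
    · exact measurableSet_snd_lt y
  have hodds : Measurable[past X θ arm t]
      fun ω => odds k (pulls arm opt t ω) (fun s => X opt s ω) y :=
    measurable_apply_nat (F := fun n ω => odds k n (fun s => X opt s ω) y)
      (fun n => measurable_odds (measurable_past_reward t opt) k n y) (measurable_past_pulls t opt)
  have h1 := h.setLIntegral_samples ht (B := fun _ => {p | p.2 < y})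
    (fun _ => measurableSet_snd_lt y) (g := fun _ => 1) measurable_const
  have h2 := h.setLIntegral_samples ht hBm hodds
  rw [setLIntegral_one] at h1
  refine (h1.trans (Eq.trans ?_ h2.symm)).trans_le (lintegral_mono_set fun ω hω => ?_)
  · refine lintegral_congr fun ω => ?_
    rw [one_mul, ← Finset.mul_prod_erase _ _ (Finset.mem_univ opt),
      ← Finset.mul_prod_erase _ _ (Finset.mem_univ opt), ← mul_assoc]
    congr 1
    · simp only [hB, if_pos]
      exact (odds_mul_tstLaw_Ici (h.n0_le_pulls ht opt ω) _ y).symm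
    · refine Finset.prod_congr rfl fun i hi => ?_
      simp only [hB, if_neg (Finset.ne_of_mem_erase hi)]
  · have hopt : y ≤ (θ t opt ω).2 := by simpa [hB] using hω opt
    by_contra hne
    have hlt : (θ t (arm t ω) ω).2 < y := by
      have := hω (arm t ω)
      simp only [hB, if_neg (show arm t ω ≠ opt from hne)] at this
      exact this
    linarith [h.argmax t ht ω opt]

/-- Reindexing by plays makes the sample size deterministic, so that only the i.i.d. rewards of one
arm remain. -/
lemma sum_measure_all_lt_le (h : IsTSTRun P μ σ k X θ arm) (opt : Fin K) (y : ℝ) (T : ℕ) :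
    ∑ t ∈ Finset.Ico (K * n0 k) T, P {ω | ∀ i, (θ t i ω).2 < y} ≤
      ∑ n ∈ Finset.Ico (n0 k) T, ∫⁻ ω, odds k n (fun s => X opt s ω) y ∂P := by
  have hodds := fun n => measurable_odds (h.measurable_reward opt) k n y
  have harm : ∀ t, MeasurableSet {ω | arm t ω = opt} := fun t =>
    h.measurable_arm t (measurableSet_singleton opt)
  set f : ℕ → Ω → ℝ≥0∞ := fun n ω => if n0 k ≤ n then odds k n (fun s => X opt s ω) y else 0
    with hf
  have hfm : ∀ n, Measurable (f n) := fun n => by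
    simp only [hf]
    split_ifs
    · exact hodds n
    · exact measurable_const
  have hpulls : ∀ t, Measurable (pulls arm opt t) := fun t =>
    (measurable_past_pulls (X := X) (θ := θ) t opt).mono (h.past_le t) le_rfl
  have hite : ∀ t, Measurable fun ω =>
      if arm t ω = opt then f (pulls arm opt t ω) ω else 0 := fun t =>
    Measurable.ite (harm t) (measurable_apply_nat hfm (hpulls t)) measurable_const
  calc _ ≤ ∑ t ∈ Finset.Ico (K * n0 k) T,
        ∫⁻ ω, (if arm t ω = opt then f (pulls arm opt t ω) ω else 0) ∂P := by
        refine Finset.sum_le_sum fun t ht => ?_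
        have ht' := (Finset.mem_Ico.1 ht).1
        refine (h.measure_all_lt_le ht' opt y).trans_eq ?_
        rw [← lintegral_indicator (harm t)]
        refine lintegral_congr fun ω => ?_
        simp only [hf, if_pos (h.n0_le_pulls ht' opt ω), indicator_apply]
        rfl
    _ ≤ ∑ t ∈ Finset.range T,
        ∫⁻ ω, (if arm t ω = opt then f (pulls arm opt t ω) ω else 0) ∂P := by
        refine Finset.sum_le_sum_of_subset fun t ht => ?_
        exact Finset.mem_range.2 (Finset.mem_Ico.1 ht).2
    _ = ∫⁻ ω, ∑ n ∈ Finset.range (pulls arm opt T ω), f n ω ∂P := by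
        rw [← lintegral_finsetSum _ fun t _ => hite t]
        exact lintegral_congr fun ω => sum_ite_arm_eq opt (fun n => f n ω) ω T
    _ ≤ ∫⁻ ω, ∑ n ∈ Finset.Ico (n0 k) T, odds k n (fun s => X opt s ω) y ∂P := by
        refine lintegral_mono fun ω => ?_
        refine (Finset.sum_le_sum_of_subset (Finset.range_mono (pulls_le opt T ω))).trans ?_
        simp only [hf]
        rw [← Finset.sum_filter]
        refine Finset.sum_le_sum_of_subset fun n hn => ?_
        simp only [Finset.mem_filter, Finset.mem_range] at hn
        exact Finset.mem_Ico.2 ⟨hn.2, hn.1⟩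
    _ = _ := lintegral_finsetSum _ fun n _ => hodds n

/-- A play of `i` has fewer than `N` predecessors, or a bad minimum, or neither. The first two are
counted by sample size, the last by rounds with probability at most `τ` each. Initial plays belong
to the first kind because `n0 k ≤ N`. -/
lemma sum_measure_arm_le [IsProbabilityMeasure P] (h : IsTSTRun P μ σ k X θ arm) (i : Fin K)
    (y c : ℝ) (T : ℕ) {N : ℕ} (hN : n0 k ≤ N) {τ : ℝ≥0∞}
    (hτ : ∀ᵐ ω ∂P, ∀ n, N ≤ n → minStat (fun s => X i s ω) n ≤ c →
      tstLaw k n (fun s => X i s ω) {p | y ≤ p.2} ≤ τ) :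
    ∑ t ∈ Finset.range T, P {ω | arm t ω = i ∧ (t < K * n0 k ∨ y ≤ (θ t i ω).2)} ≤
      N + ∑ n ∈ Finset.Ico N T, P {ω | c < minStat (fun s => X i s ω) n} + T * τ := by
  have hpulls : ∀ t, Measurable (pulls arm i t) := fun t =>
    (measurable_past_pulls (X := X) (θ := θ) t i).mono (h.past_le t) le_rfl
  have hbad : ∀ n, MeasurableSet {ω | c < minStat (fun s => X i s ω) n} := fun n =>
    measurableSet_lt measurable_const (measurable_minStat (h.measurable_reward i) n)
  set f : ℕ → Ω → ℝ≥0∞ := fun n ω => if n < N then 1 else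
    {ω | c < minStat (fun s => X i s ω) n}.indicator (fun _ => 1) ω with hf
  have hfm : ∀ n, Measurable (f n) := fun n => by
    simp only [hf]
    split_ifs
    · exact measurable_const
    · exact measurable_const.indicator (hbad n)
  have harm : ∀ t, MeasurableSet {ω | arm t ω = i} := fun t =>
    h.measurable_arm t (measurableSet_singleton i)
  have hite : ∀ t, Measurable fun ω =>
      if arm t ω = i then f (pulls arm i t ω) ω else 0 := fun t =>
    Measurable.ite (harm t) (measurable_apply_nat hfm (hpulls t)) measurable_const
  set G : ℕ → Set Ω := fun t => {ω | K * n0 k ≤ t ∧ N ≤ pulls arm i t ω ∧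
    minStat (fun s => X i s ω) (pulls arm i t ω) ≤ c} with hG
  have hGm : ∀ t, MeasurableSet[past X θ arm t] (G t) := fun t => by
    have h1 : Measurable[past X θ arm t]
        fun ω => minStat (fun s => X i s ω) (pulls arm i t ω) :=
      measurable_apply_nat (F := fun n ω => minStat (fun s => X i s ω) n)
        (fun n => @measurable_minStat Ω (past X θ arm t) (X i) (measurable_past_reward t i) n)
        (measurable_past_pulls t i)
    have h2 := measurable_past_pulls (X := X) (θ := θ) (arm := arm) t i
    exact (@MeasurableSet.const _ (past X θ arm t) _).inter
      ((h2 (measurableSet_Ici (a := N))).inter (h1 (measurableSet_Iic (a := c))))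
  have hGτ : ∀ t, P (G t ∩ {ω | y ≤ (θ t i ω).2}) ≤ τ := by
    intro t
    by_cases ht : K * n0 k ≤ t
    swap
    · have : G t = ∅ := by ext ω; simp [hG, ht]
      rw [this]; simp
    set B : Fin K → Set (ℝ × ℝ) := fun j => if j = i then {p | y ≤ p.2} else univ with hB
    have hBm : ∀ j, MeasurableSet (B j) := fun j => by
      simp only [hB]
      split_ifs
      · exact measurableSet_le_snd y
      · exact MeasurableSet.univ
    have hset : {ω | ∀ j, θ t j ω ∈ B j} = {ω | y ≤ (θ t i ω).2} := by
      ext ω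
      constructor
      · intro hω; simpa [hB] using hω i
      · intro hω j
        simp only [hB]
        split_ifs with hj
        · subst hj; exact hω
        · exact mem_univ _
    have hsl := h.sample_law t ht (G t) (hGm t) B hBm
    rw [hset] at hsl
    rw [hsl]
    have hGm' := h.past_le t _ (hGm t)
    calc _ ≤ ∫⁻ ω in G t, τ ∂P := by
          refine lintegral_mono_ae ?_
          filter_upwards [ae_restrict_of_ae hτ, ae_restrict_mem hGm'] with ω hω hωG
          rw [← Finset.mul_prod_erase _ _ (Finset.mem_univ i), Finset.prod_eq_one, mul_one]
          · simp only [hB, if_pos]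
            exact hω _ hωG.2.1 hωG.2.2
          · intro j hj
            simp only [hB, if_neg (Finset.ne_of_mem_erase hj)]
            have := isProbabilityMeasure_tstLaw (h.n0_le_pulls ht j ω) (fun s => X j s ω)
            exact measure_univ
      _ ≤ τ := by
          rw [setLIntegral_const]
          exact mul_le_of_le_one_right' prob_le_one
  have hstep : ∀ t ∈ Finset.range T, P {ω | arm t ω = i ∧ (t < K * n0 k ∨ y ≤ (θ t i ω).2)} ≤
      ∫⁻ ω, (if arm t ω = i then f (pulls arm i t ω) ω else 0) ∂P + τ := by
    intro t _
    set A := {ω | arm t ω = i ∧ (pulls arm i t ω < N ∨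
      c < minStat (fun s => X i s ω) (pulls arm i t ω))} with hA
    have hsub : {ω | arm t ω = i ∧ (t < K * n0 k ∨ y ≤ (θ t i ω).2)} ⊆
        A ∪ (G t ∩ {ω | y ≤ (θ t i ω).2}) := by
      rintro ω ⟨hi, hω⟩
      by_cases hA' : pulls arm i t ω < N ∨ c < minStat (fun s => X i s ω) (pulls arm i t ω)
      · exact Or.inl ⟨hi, hA'⟩
      · push Not at hA'
        have ht : K * n0 k ≤ t := by
          by_contra! hlt
          exact absurd (h.pulls_lt_n0 hlt hi) (by omega)
        refine Or.inr ⟨⟨ht, hA'.1, hA'.2⟩, ?_⟩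
        rcases hω with hω | hω
        · omega
        · exact hω
    refine (measure_mono hsub).trans ((measure_union_le _ _).trans (add_le_add ?_ (hGτ t)))
    have hAm : MeasurableSet A := by
      have h1 : Measurable fun ω => minStat (fun s => X i s ω) (pulls arm i t ω) :=
        measurable_apply_nat (F := fun n ω => minStat (fun s => X i s ω) n)
          (fun n => measurable_minStat (h.measurable_reward i) n) (hpulls t)
      exact (harm t).inter ((measurableSet_lt (hpulls t) measurable_const).union
        (measurableSet_lt measurable_const h1))
    rw [← lintegral_indicator_one hAm]
    refine lintegral_mono fun ω => ?_
    by_cases hω : ω ∈ A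
    · rw [indicator_of_mem hω]
      obtain ⟨h1, h2⟩ := hω
      simp only [hf, if_pos h1, Pi.one_apply]
      split_ifs with h3
      · exact le_rfl
      · rw [indicator_of_mem]
        exact h2.resolve_left h3
    · rw [indicator_of_notMem hω]
      exact zero_le
  refine (Finset.sum_le_sum hstep).trans ?_
  rw [Finset.sum_add_distrib, Finset.sum_const, Finset.card_range, nsmul_eq_mul]
  gcongr
  rw [← lintegral_finsetSum _ fun t _ => hite t]
  calc _ ≤ ∫⁻ ω, (N + ∑ n ∈ Finset.Ico N T,
        {ω | c < minStat (fun s => X i s ω) n}.indicator (fun _ => 1) ω) ∂P := by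
        refine lintegral_mono fun ω => ?_
        rw [sum_ite_arm_eq i (fun n => f n ω) ω T]
        refine (Finset.sum_le_sum_of_subset (Finset.range_mono (pulls_le i T ω))).trans ?_
        simp only [hf]
        rw [Finset.sum_ite]
        gcongr
        · rw [Finset.sum_const, nsmul_one]
          have : (Finset.filter (fun n => n < N) (Finset.range T)).card ≤ N := by
            refine (Finset.card_le_card (t := Finset.range N) fun n hn => ?_).trans_eq
              (Finset.card_range N)
            exact Finset.mem_range.2 (Finset.mem_filter.1 hn).2
          exact_mod_cast this
        · intro n hn
          simp only [Finset.mem_filter, Finset.mem_range, not_lt] at hn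
          exact Finset.mem_Ico.2 ⟨hn.2, hn.1⟩
    _ = _ := by
        rw [lintegral_add_left measurable_const, lintegral_const, measure_univ, mul_one,
          lintegral_finsetSum _ fun n _ => measurable_const.indicator (hbad n)]
        congr 1
        refine Finset.sum_congr rfl fun n _ => ?_
        rw [lintegral_indicator_const (hbad n), one_mul]

end IsTSTRun

end Dynamics

section RegretBound

/-! ### Growth of the constant of the optimal arm. -/

section Growth

lemma optConst_nonneg {ε k σ : ℝ} (hε : 0 < ε) (hσ : 0 < σ) : 0 ≤ optConst ε k σ :=
  le_trans (by have := excessConst_nonneg (k := k) hε hσ; positivity) (le_optConst hε hσ)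

lemma optConst_le_of_lt_one {k ε₀ σ₀ ε σ : ℝ} (hk : k < 1) (hσ₀ : 0 < σ₀)
    (hε : 0 < ε) (hεε : ε ≤ ε₀) (hσσ : σ₀ ≤ σ) :
    optConst ε k σ ≤ ((ε₀ / σ₀) ^ 2 + 9 * (ε₀ / σ₀) + 3 / 16 * max 1 (1 / (1 - k)) *
      (2 * Real.exp (2 * (ε₀ / σ₀)))) * (σ ^ 2 / ε ^ 2) := by
  have hσ : 0 < σ := hσ₀.trans_le hσσ
  have hv : ε / σ ≤ ε₀ / σ₀ := by
    have : 0 < ε₀ := hε.trans_le hεε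
    gcongr
  have hM : 0 < max 1 (1 / (1 - k)) := lt_max_of_lt_left one_pos
  rw [optConst, if_pos hk]
  set v := ε / σ with hvdef
  have hv0 : 0 < v := by positivity
  have h1 : σ ^ 2 / ε ^ 2 = 1 / v ^ 2 := by rw [hvdef]; field_simp
  have h2 : 9 * σ / ε = 9 * v * (1 / v ^ 2) := by rw [hvdef]; field_simp
  have h3 : 2 * ε / σ = 2 * v := by rw [hvdef]; ring
  have h4 : (1 : ℝ) = v ^ 2 * (1 / v ^ 2) := by field_simp
  rw [h1, h2, h3]
  calc _ = (v ^ 2 + 9 * v + 3 / 16 * max 1 (1 / (1 - k)) * (2 * Real.exp (2 * v) - 1)) *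
        (1 / v ^ 2) := by nth_rewrite 1 [h4]; ring
    _ ≤ _ := by
      gcongr
      linarith [Real.exp_le_exp.2 (by linarith : 2 * v ≤ 2 * (ε₀ / σ₀))]

lemma exists_optConst_one_le {ε₀ σ₀ : ℝ} (hε₀ : 0 < ε₀) (hσ₀ : 0 < σ₀) :
    ∃ c : ℝ, 0 ≤ c ∧ ∀ ε σ, 0 < ε → ε ≤ ε₀ → σ₀ ≤ σ →
      optConst ε 1 σ ≤ c * (σ ^ 2 * Real.log (1 + σ / ε) / ε ^ 2) := by
  set u₀ := σ₀ / ε₀ with hu₀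
  have hu₀0 : 0 < u₀ := by positivity
  have hℓ₀ : 0 < Real.log (1 + u₀) := Real.log_pos (by linarith)
  have hlε : 0 ≤ Real.log (1 + ε₀) := Real.log_nonneg (by linarith)
  set A := 2 / u₀ ^ 2 + 4 / (3 * u₀) + (33 + Real.log (1 + ε₀)) / 9 with hA
  have hA0 : 0 ≤ A := by positivity
  refine ⟨A / Real.log (1 + u₀) + 2 / 9, by positivity, fun ε σ hε hεε hσσ => ?_⟩
  have hσ : 0 < σ := hσ₀.trans_le hσσ
  rw [optConst, if_neg (lt_irrefl _), excessConst, if_neg (lt_irrefl _), if_pos rfl]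
  set u := σ / ε with hu
  have hu0 : 0 < u := by positivity
  have huu : u₀ ≤ u := by rw [hu, hu₀]; gcongr
  have hℓ : Real.log (1 + u₀) ≤ Real.log (1 + u) := Real.log_le_log (by positivity) (by linarith)
  have h1 : σ ^ 2 / (9 * ε ^ 2) = u ^ 2 / 9 := by rw [hu]; field_simp
  have h2 : σ ^ 2 * Real.log (1 + u) / ε ^ 2 = u ^ 2 * Real.log (1 + u) := by rw [hu]; field_simp
  have h3 : σ ^ 2 / (3 * ε) = u ^ 2 * ε / 3 := by rw [hu]; field_simp
  -- Since `σ ^ 2 / ε = u ^ 2 * ε`, the argument is at most `(1 + u) ^ 2 * (1 + ε₀)`.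
  have hlog : Real.log (1 + σ ^ 2 / (3 * ε)) ≤ 2 * Real.log (1 + u) + Real.log (1 + ε₀) := by
    rw [h3, show 2 * Real.log (1 + u) = Real.log ((1 + u) ^ 2) by rw [Real.log_pow]; norm_num,
      ← Real.log_mul (by positivity) (by positivity)]
    apply Real.log_le_log (by positivity)
    have : u ^ 2 * ε ≤ u ^ 2 * ε₀ := by gcongr
    nlinarith [mul_pos hu0 hε₀, sq_nonneg u, mul_nonneg (sq_nonneg u) hε₀.le]
  rw [h1, h2]
  have h4 : 2 ≤ 2 / u₀ ^ 2 * u ^ 2 := by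
    rw [div_mul_eq_mul_div, le_div_iff₀ (by positivity)]
    gcongr
  have h5 : 4 / 3 * u ≤ 4 / (3 * u₀) * u ^ 2 := by
    rw [div_mul_eq_mul_div 4 (3 * u₀), le_div_iff₀ (by positivity)]
    nlinarith
  have h6 : A * u ^ 2 ≤ A / Real.log (1 + u₀) * (u ^ 2 * Real.log (1 + u)) := by
    rw [div_mul_eq_mul_div, le_div_iff₀ hℓ₀, ← mul_assoc]
    gcongr
  have h7 : (33 + Real.log (1 + σ ^ 2 / (3 * ε))) * (u ^ 2 / 9) ≤
      (33 + (2 * Real.log (1 + u) + Real.log (1 + ε₀))) * (u ^ 2 / 9) := by gcongr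
  calc _ ≤ A * u ^ 2 + 2 / 9 * (u ^ 2 * Real.log (1 + u)) := by
        rw [hA]; linarith
    _ ≤ _ := by linarith

lemma exists_optConst_le_of_one_lt {k ε₀ σ₀ : ℝ} (hk : 1 < k) (hε₀ : 0 < ε₀) (hσ₀ : 0 < σ₀) :
    ∃ c : ℝ, ∀ ε σ, 0 < ε → ε ≤ ε₀ → σ₀ ≤ σ →
      optConst ε k σ ≤ c * (σ ^ (2 * k) / ε ^ (k + 1)) := by
  set u₀ := σ₀ / ε₀ with hu₀
  have hu₀0 : 0 < u₀ := by positivity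
  have hk0 : 0 < k := by linarith
  have hk1 : 0 < k - 1 := by linarith
  refine ⟨2 / (u₀ ^ (k + 1) * σ₀ ^ (k - 1)) + 4 / 3 / (u₀ ^ k * σ₀ ^ (k - 1)) +
    k / (k - 1) * (2 * (2 * k) ^ k) / 3 ^ (k + 1), fun ε σ hε hεε hσσ => ?_⟩
  have hσ : 0 < σ := hσ₀.trans_le hσσ
  rw [optConst, if_neg (by linarith), excessConst, if_neg (by linarith), if_neg (by linarith)]
  have huu : u₀ ≤ σ / ε := by rw [hu₀]; gcongr
  have hu0 : 0 < σ / ε := by positivity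
  have hg : σ ^ (2 * k) / ε ^ (k + 1) = (σ / ε) ^ (k + 1) * σ ^ (k - 1) := by
    rw [Real.div_rpow hσ.le hε.le, div_mul_eq_mul_div, ← Real.rpow_add hσ]
    ring_nf
  have h1 : (3 * ε) ^ (k + 1) = 3 ^ (k + 1) * ε ^ (k + 1) := Real.mul_rpow (by norm_num) hε.le
  have hσk : σ₀ ^ (k - 1) ≤ σ ^ (k - 1) := Real.rpow_le_rpow hσ₀.le hσσ hk1.le
  have h2 : 2 ≤ 2 / (u₀ ^ (k + 1) * σ₀ ^ (k - 1)) * (σ ^ (2 * k) / ε ^ (k + 1)) := by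
    rw [hg, div_mul_eq_mul_div, le_div_iff₀ (by positivity)]
    have : u₀ ^ (k + 1) ≤ (σ / ε) ^ (k + 1) := Real.rpow_le_rpow hu₀0.le huu (by linarith)
    gcongr
  have h3 : 4 / 3 * (σ / ε) ≤
      4 / 3 / (u₀ ^ k * σ₀ ^ (k - 1)) * (σ ^ (2 * k) / ε ^ (k + 1)) := by
    rw [hg, div_mul_eq_mul_div (4 / 3) (u₀ ^ k * σ₀ ^ (k - 1)), le_div_iff₀ (by positivity),
      Real.rpow_add_one hu0.ne',
      show 4 / 3 * (σ / ε) * (u₀ ^ k * σ₀ ^ (k - 1)) =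
        4 / 3 * (u₀ ^ k * (σ / ε) * σ₀ ^ (k - 1)) by ring]
    have : u₀ ^ k ≤ (σ / ε) ^ k := Real.rpow_le_rpow hu₀0.le huu (by linarith)
    gcongr
  have h4 : k / (k - 1) * (2 * (2 * k) ^ k) * (σ ^ (2 * k) / (3 * ε) ^ (k + 1)) =
      k / (k - 1) * (2 * (2 * k) ^ k) / 3 ^ (k + 1) * (σ ^ (2 * k) / ε ^ (k + 1)) := by
    rw [h1, mul_comm (3 ^ (k + 1) : ℝ), ← div_div]
    ring
  rw [h4]
  linarith

lemma isBigO_optConst_of_lt_one {k ε₀ σ₀ : ℝ} (hk : k < 1) (hσ₀ : 0 < σ₀) :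
    (fun p : ℝ × ℝ => optConst p.1 k p.2) =O[𝓟 (Ioc 0 ε₀ ×ˢ Ici σ₀)]
      (fun p : ℝ × ℝ => p.2 ^ 2 / p.1 ^ 2) := by
  obtain ⟨c, hbound⟩ : ∃ c : ℝ, ∀ ε σ, 0 < ε → ε ≤ ε₀ → σ₀ ≤ σ →
      optConst ε k σ ≤ c * (σ ^ 2 / ε ^ 2) :=
    ⟨_, fun ε σ hε hεε hσσ => optConst_le_of_lt_one hk hσ₀ hε hεε hσσ⟩
  refine IsBigO.of_bound c (eventually_principal.2 ?_)
  rintro ⟨ε, σ⟩ ⟨⟨hε, hεε⟩, hσσ⟩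
  rw [Real.norm_of_nonneg (optConst_nonneg hε (hσ₀.trans_le hσσ)),
    Real.norm_of_nonneg (by positivity)]
  exact hbound ε σ hε hεε hσσ

lemma isBigO_optConst_one {ε₀ σ₀ : ℝ} (hε₀ : 0 < ε₀) (hσ₀ : 0 < σ₀) :
    (fun p : ℝ × ℝ => optConst p.1 1 p.2) =O[𝓟 (Ioc 0 ε₀ ×ˢ Ici σ₀)]
      (fun p : ℝ × ℝ => p.2 ^ 2 * Real.log (1 + p.2 / p.1) / p.1 ^ 2) := by
  obtain ⟨c, -, hbound⟩ := exists_optConst_one_le hε₀ hσ₀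
  refine IsBigO.of_bound c (eventually_principal.2 ?_)
  rintro ⟨ε, σ⟩ ⟨⟨hε, hεε⟩, hσσ⟩
  have hσ : 0 < σ := hσ₀.trans_le hσσ
  rw [Real.norm_of_nonneg (optConst_nonneg hε hσ)]
  exact (hbound ε σ hε hεε hσσ).trans_eq (by
    simp only at hε ⊢
    have : 0 ≤ Real.log (1 + σ / ε) := Real.log_nonneg (by linarith [div_pos hσ hε])
    rw [Real.norm_of_nonneg (by positivity)])

/-- For `ε ≥ ε₁` and `σ ≥ 1` one has `1 + σ / ε ≤ σ * (1 + 1 / ε₁)`; the additive constant in the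
logarithm is absorbed because `log σ ≥ log σ₀ > 0`. -/
lemma isBigO_optConst_one_of_le {ε₁ ε₀ σ₀ : ℝ} (hε₁ : 0 < ε₁) (hσ₀ : 1 < σ₀) :
    (fun p : ℝ × ℝ => optConst p.1 1 p.2) =O[𝓟 (Icc ε₁ ε₀ ×ˢ Ici σ₀)]
      (fun p : ℝ × ℝ => p.2 ^ 2 * Real.log p.2 / p.1 ^ 2) := by
  -- No sign of `ε₀` is assumed, hence the maximum with `1`.
  obtain ⟨c, hc, hbound⟩ := exists_optConst_one_le (ε₀ := max ε₀ 1) (σ₀ := σ₀)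
    (lt_max_of_lt_right one_pos) (by linarith)
  have hℓ₀ : 0 < Real.log σ₀ := Real.log_pos hσ₀
  have hℓ₁ : 0 ≤ Real.log (1 + 1 / ε₁) :=
    Real.log_nonneg (by linarith [one_div_pos.2 hε₁])
  refine IsBigO.of_bound (c * (1 + Real.log (1 + 1 / ε₁) / Real.log σ₀))
    (eventually_principal.2 ?_)
  rintro ⟨ε, σ⟩ ⟨⟨hε, hεε⟩, hσσ⟩
  simp only at hε hεε hσσ ⊢
  have hσσ' : σ₀ ≤ σ := hσσ
  have hσ : 1 < σ := hσ₀.trans_le hσσ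
  have hε0 : 0 < ε := hε₁.trans_le hε
  have hℓ : Real.log σ₀ ≤ Real.log σ := Real.log_le_log (by linarith) hσσ'
  have hℓ0 : 0 < Real.log σ := hℓ₀.trans_le hℓ
  rw [Real.norm_of_nonneg (optConst_nonneg hε0 (by linarith)),
    Real.norm_of_nonneg (by positivity)]
  refine (hbound ε σ hε0 (hεε.trans (le_max_left _ _)) hσσ).trans ?_
  rw [mul_assoc]
  refine mul_le_mul_of_nonneg_left ?_ hc
  have hlog : Real.log (1 + σ / ε) ≤ (1 + Real.log (1 + 1 / ε₁) / Real.log σ₀) * Real.log σ := by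
    have h1 : 1 + σ / ε ≤ σ * (1 + 1 / ε₁) := by
      have : σ / ε ≤ σ / ε₁ := by gcongr
      rw [mul_add, mul_one, mul_one_div]
      linarith
    have h2 := Real.log_le_log (by positivity) h1
    rw [Real.log_mul (by positivity) (by positivity)] at h2
    have h3 : Real.log (1 + 1 / ε₁) ≤ Real.log (1 + 1 / ε₁) / Real.log σ₀ * Real.log σ := by
      rw [div_mul_eq_mul_div, le_div_iff₀ hℓ₀]
      gcongr
    linarith
  calc _ ≤ σ ^ 2 * ((1 + Real.log (1 + 1 / ε₁) / Real.log σ₀) * Real.log σ) / ε ^ 2 := by gcongr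
    _ = _ := by ring

lemma isBigO_optConst_of_one_lt {k ε₀ σ₀ : ℝ} (hk : 1 < k) (hε₀ : 0 < ε₀) (hσ₀ : 0 < σ₀) :
    (fun p : ℝ × ℝ => optConst p.1 k p.2) =O[𝓟 (Ioc 0 ε₀ ×ˢ Ici σ₀)]
      (fun p : ℝ × ℝ => p.2 ^ (2 * k) / p.1 ^ (k + 1)) := by
  obtain ⟨c, hbound⟩ := exists_optConst_le_of_one_lt hk hε₀ hσ₀
  refine IsBigO.of_bound c (eventually_principal.2 ?_)
  rintro ⟨ε, σ⟩ ⟨⟨hε, hεε⟩, hσσ⟩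
  simp only at hε hεε hσσ ⊢
  have hσ : 0 < σ := hσ₀.trans_le hσσ
  rw [Real.norm_of_nonneg (optConst_nonneg hε hσ), Real.norm_of_nonneg (by positivity)]
  exact hbound ε σ hε hεε hσσ

end Growth

/-! ### Finite-time regret and asymptotic optimality. -/

namespace IsTSTRun

variable {Ω : Type*} {K : ℕ} [mΩ : MeasurableSpace Ω] {P : Measure Ω} {μ σ : Fin K → ℝ} {k : ℝ}
  {X : Fin K → ℕ → Ω → ℝ} {θ : ℕ → Fin K → Ω → ℝ × ℝ} {arm : ℕ → Ω → Fin K}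

lemma indep_reward (h : IsTSTRun P μ σ k X θ arm) (i : Fin K) : iIndepFun (X i) P :=
  h.reward_indep.precomp (g := fun s => (i, s)) fun s s' hs => by simpa using hs

/-- With `1/n ≤ s` the truncated range is at most `s`. Minimum and truncated maximum exceed their
endpoints by at most `ε / 2`, so the midpoint is at most `m + ε / 2` and lies at least `Δ - 2 * ε`
below the threshold. -/
lemma tstLaw_Ici_le {n : ℕ} {x : ℕ → ℝ} {m s ε Δ L : ℝ} (hs : 0 < s) (hε : 0 < ε)
    (hΔ : 0 < 2 * Δ - 4 * ε) (hn : n0 k ≤ n) (hns : 1 / s ≤ n) (hL : L ≤ (n : ℝ) + k - 2)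
    (hx : ∀ j, x j ∈ Icc (m - s / 2) (m + s / 2)) (hmin : minStat x n ≤ m - s / 2 + ε / 2) :
    tstLaw k n x {p | m + Δ - 3 * ε / 2 ≤ p.2} ≤
      ENNReal.ofReal (1 / 2 * (1 + (2 * Δ - 4 * ε) / s) ^ (-L)) := by
  have hn' : 0 < n := by linarith [two_le_n0 k]
  have hb0 := truncRange_pos x hn'
  obtain ⟨j, -, hj⟩ := exists_minStat x hn'
  obtain ⟨l, -, hl⟩ := exists_maxStat x hn'
  have hmin' : m - s / 2 ≤ minStat x n := hj ▸ (hx j).1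
  have hmax : maxStat x n ≤ m + s / 2 := hl ▸ (hx l).2
  have hinv : 1 / (n : ℝ) ≤ s := by
    rw [one_div_le (by positivity) hs]; exact hns
  have htrunc : truncMax x n ≤ m + s / 2 + ε / 2 := max_le (by linarith) (by linarith)
  have hb : truncMax x n - minStat x n ≤ s := by
    rw [truncMax_sub_minStat]; exact max_le hinv (by linarith)
  rw [tstLaw_Ici hn x (by linarith)]
  set b := truncMax x n - minStat x n
  set d := m + Δ - 3 * ε / 2 - (minStat x n + truncMax x n) / 2 with hd
  have hdΔ : 2 * Δ - 4 * ε ≤ 2 * d := by linarith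
  set η := (2 * Δ - 4 * ε) / s with hη
  have hη0 : 0 < η := by positivity
  have hbη : b * η ≤ 2 * d := by
    have : b * η ≤ s * η := by gcongr
    rw [hη, mul_div_cancel₀ _ hs.ne'] at this
    linarith
  apply ENNReal.ofReal_le_ofReal
  refine mul_le_mul_of_nonneg_left ?_ (by norm_num)
  rw [Real.rpow_neg (by positivity), ← Real.inv_rpow (by positivity)]
  have hd0 : 0 < d := by linarith
  calc _ ≤ (1 + η)⁻¹ ^ ((n : ℝ) + k - 2) := by
        apply Real.rpow_le_rpow (by positivity) _ (posterior_index_pos hn).le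
        rw [div_le_iff₀ (by positivity), ← div_eq_inv_mul, le_div_iff₀ (by positivity)]
        linarith
    _ ≤ _ := Real.rpow_le_rpow_of_exponent_ge (by positivity)
        (inv_le_one_of_one_le₀ (by linarith)) hL

lemma sum_measure_suboptimal_le [IsProbabilityMeasure P] (h : IsTSTRun P μ σ k X θ arm)
    {i : Fin K} (hσ : 0 < σ i) {ε Δ : ℝ} (hε : 0 < ε) (hΔ : ε < Δ / 2) (T : ℕ) :
    ∑ t ∈ Finset.range T,
        P {ω | arm t ω = i ∧ (t < K * n0 k ∨ μ i + Δ - 3 * ε / 2 ≤ (θ t i ω).2)} ≤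
      ENNReal.ofReal (Real.log T / Real.log (1 + (2 * Δ - 4 * ε) / σ i) + 2 * σ i / ε +
        1 / σ i + max (7 / 2) (9 / 2 - (⌈k⌉ : ℝ))) := by
  set η := (2 * Δ - 4 * ε) / σ i with hη
  have hη0 : 0 < η := div_pos (by linarith) hσ
  have hlog : 0 < Real.log (1 + η) := Real.log_pos (by linarith)
  set L := Real.log T / Real.log (1 + η) with hL
  have hL0 : 0 ≤ L := div_nonneg (Real.log_natCast_nonneg T) hlog.le
  -- The summands serve in turn to get `1/n ≤ σ i`, a positive posterior index, and an exponent of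
  -- at least `L`, for which the tail is `1 / (2 * T)`.
  set N := ⌈1 / σ i + n0 k + L⌉₊ with hN
  have hNle : 1 / σ i + n0 k + L ≤ N := Nat.le_ceil _
  have hNlt : (N : ℝ) < 1 / σ i + n0 k + L + 1 := Nat.ceil_lt_add_one (by positivity)
  have hinv : 0 < 1 / σ i := by positivity
  have hNn0 : n0 k ≤ N := by
    have : (n0 k : ℝ) ≤ N := by linarith
    exact_mod_cast this
  have hsum := h.sum_measure_arm_le i (μ i + Δ - 3 * ε / 2) (μ i - σ i / 2 + ε / 2) T hNn0
    (τ := ENNReal.ofReal (1 / 2 * (1 + η) ^ (-L))) (by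
      filter_upwards [ae_mem_support (h.measurable_reward i) (h.reward_law i)] with ω hω n hn hmin
      have hn' : (N : ℝ) ≤ n := by exact_mod_cast hn
      have h0 : (0 : ℝ) ≤ n0 k := Nat.cast_nonneg _
      exact tstLaw_Ici_le hσ hε (by linarith) (hNn0.trans hn) (by linarith)
        (by linarith [two_sub_le_n0 k]) hω hmin)
  have hbad : ∑ n ∈ Finset.Ico N T, P {ω | μ i - σ i / 2 + ε / 2 < minStat (fun s => X i s ω) n} ≤
      ENNReal.ofReal (2 * σ i / ε) := by
    calc _ ≤ ∑ n ∈ Finset.Ico N T, ENNReal.ofReal (1 - ε / 2 / σ i) ^ n :=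
          Finset.sum_le_sum fun n _ => measure_lt_minStat (h.measurable_reward i) (h.reward_law i)
            (h.indep_reward i) hσ (ε / 2) n
      _ ≤ ENNReal.ofReal (1 / (ε / 2 / σ i)) :=
          sum_pow_ofReal_le (by positivity) (by linarith [two_le_n0 k]) T
      _ = _ := by congr 1; field_simp
  have hτ : (T : ℝ≥0∞) * ENNReal.ofReal (1 / 2 * (1 + η) ^ (-L)) ≤ ENNReal.ofReal (1 / 2) := by
    rw [← ENNReal.ofReal_natCast, ← ENNReal.ofReal_mul (by positivity)]
    apply ENNReal.ofReal_le_ofReal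
    rcases Nat.eq_zero_or_pos T with rfl | hT
    · simp
    · have hT' : (0 : ℝ) < T := by exact_mod_cast hT
      have hpow : (1 + η) ^ (-L) = (T : ℝ)⁻¹ := by
        rw [Real.rpow_def_of_pos (by positivity), mul_neg, hL, mul_div_cancel₀ _ hlog.ne',
          Real.exp_neg, Real.exp_log hT']
      rw [hpow]
      field_simp
      exact le_rfl
  refine hsum.trans ((add_le_add (add_le_add le_rfl hbad) hτ).trans ?_)
  rw [← ENNReal.ofReal_natCast, ← ENNReal.ofReal_add (by positivity) (by positivity),
    ← ENNReal.ofReal_add (by positivity) (by positivity)]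
  apply ENNReal.ofReal_le_ofReal
  -- The `3/2` is `1` from rounding up to `N` plus `1/2` from `T` rounds of probability `1 / (2 *
  -- T)`.
  have hmax : (n0 k : ℝ) + 3 / 2 = max (7 / 2) (9 / 2 - (⌈k⌉ : ℝ)) := by
    rw [n0_cast, ← max_add_add_right]
    congr 1 <;> ring
  rw [← hmax]
  linarith

lemma sum_measure_optimal_le [IsProbabilityMeasure P] (h : IsTSTRun P μ σ k X θ arm)
    {opt : Fin K} (hσ : 0 < σ opt) {ε : ℝ} (hε : 0 < ε) (T : ℕ) :
    ∑ t ∈ Finset.Ico (K * n0 k) T, P {ω | ∀ i, (θ t i ω).2 < μ opt - 3 * ε / 2} ≤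
      ENNReal.ofReal (optConst ε k (σ opt)) :=
  (h.sum_measure_all_lt_le opt _ T).trans <|
    (sum_lintegral_odds_le (h.measurable_reward opt) (h.reward_law opt) (h.indep_reward opt) hσ hε
      k T).trans (ENNReal.ofReal_le_ofReal (le_optConst hε hσ))

lemma integral_regret_le [IsProbabilityMeasure P] (h : IsTSTRun P μ σ k X θ arm)
    {opt : Fin K} (hσ : ∀ i, 0 < σ i) (hopt : ∀ i, i ≠ opt → μ i < μ opt) {ε : ℝ} (hε : 0 < ε)
    (hΔ : ∀ i, i ≠ opt → ε < (μ opt - μ i) / 2) (T : ℕ) :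
    ∫ ω, regret μ opt arm T ω ∂P ≤
      ∑ i ∈ Finset.univ.erase opt, (μ opt - μ i) *
        (Real.log T / Real.log (1 + (2 * (μ opt - μ i) - 4 * ε) / σ i) + 2 * σ i / ε +
          1 / σ i + max (7 / 2) (9 / 2 - (⌈k⌉ : ℝ))) +
      Finset.univ.sup' ⟨opt, Finset.mem_univ opt⟩ (fun i => μ opt - μ i) *
        optConst ε k (σ opt) := by
  -- The optimal arm contributes the gap `0`, so `D` is nonnegative and also makes sense for a
  -- single arm.
  set D := Finset.univ.sup' ⟨opt, Finset.mem_univ opt⟩ (fun i => μ opt - μ i) with hD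
  have hDle : ∀ i, μ opt - μ i ≤ D := fun i =>
    Finset.le_sup' (fun i => μ opt - μ i) (Finset.mem_univ i)
  have hD0 : 0 ≤ D := by simpa using hDle opt
  have hΔ0 : ∀ i, 0 ≤ μ opt - μ i := fun i => by
    by_cases hi : i = opt
    · simp [hi]
    · linarith [hopt i hi]
  set y := μ opt - 3 * ε / 2 with hy
  set W : ℕ → Fin K → Set Ω := fun t i =>
    {ω | arm t ω = i ∧ (t < K * n0 k ∨ y ≤ (θ t i ω).2)} with hW
  set E : ℕ → Set Ω := fun t => {ω | K * n0 k ≤ t ∧ ∀ i, (θ t i ω).2 < y} with hE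
  have hWm : ∀ t i, MeasurableSet (W t i) := fun t i =>
    (h.measurable_arm t (measurableSet_singleton i)).inter
      ((MeasurableSet.const _).union (h.measurable_sample t i (measurableSet_le_snd y)))
  have hEm : ∀ t, MeasurableSet (E t) := fun t => by
    have hs : MeasurableSet {ω | ∀ i, (θ t i ω).2 < y} := by
      rw [ofPred_forall]
      exact MeasurableSet.iInter fun i => h.measurable_sample t i (measurableSet_snd_lt y)
    exact (MeasurableSet.const _).inter hs
  set g : ℕ → Ω → ℝ := fun t ω => ∑ i ∈ Finset.univ.erase opt,
    (μ opt - μ i) * (W t i).indicator 1 ω + D * (E t).indicator 1 ω with hg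
  have hind : ∀ {S : Set Ω}, MeasurableSet S → Integrable (S.indicator (1 : Ω → ℝ)) P :=
    fun hS => (integrable_const (1 : ℝ)).indicator hS
  have hgi : ∀ t, Integrable (g t) P := fun t =>
    (integrable_finsetSum _ fun i _ => (hind (hWm t i)).const_mul _).add
      ((hind (hEm t)).const_mul _)
  have hpt : ∀ t ω, μ opt - μ (arm t ω) ≤ g t ω := by
    intro t ω
    have h1 : ∀ (S : Set Ω), 0 ≤ S.indicator (1 : Ω → ℝ) ω := fun S =>
      indicator_nonneg (fun _ _ => zero_le_one) ω
    have hs0 : ∀ i ∈ Finset.univ.erase opt, 0 ≤ (μ opt - μ i) * (W t i).indicator (1 : Ω → ℝ) ω :=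
      fun i _ => mul_nonneg (hΔ0 i) (h1 _)
    have hsum0 := Finset.sum_nonneg hs0
    have hE0 : 0 ≤ D * (E t).indicator (1 : Ω → ℝ) ω := mul_nonneg hD0 (h1 _)
    by_cases hj : arm t ω = opt
    · rw [hj, sub_self]; exact add_nonneg hsum0 hE0
    by_cases hjW : ω ∈ W t (arm t ω)
    · have := Finset.single_le_sum hs0 (Finset.mem_erase.2 ⟨hj, Finset.mem_univ _⟩)
      rw [indicator_of_mem hjW, Pi.one_apply, mul_one] at this
      linarith
    · have hjW' : ¬ (t < K * n0 k ∨ y ≤ (θ t (arm t ω) ω).2) := fun hc => hjW ⟨rfl, hc⟩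
      push Not at hjW'
      have hEω : ω ∈ E t := ⟨hjW'.1, fun i => (h.argmax t hjW'.1 ω i).trans_lt hjW'.2⟩
      have : D * (E t).indicator (1 : Ω → ℝ) ω = D := by
        rw [indicator_of_mem hEω, Pi.one_apply, mul_one]
      linarith [hDle (arm t ω)]
  have hle : ∫ ω, regret μ opt arm T ω ∂P ≤ ∫ ω, ∑ t ∈ Finset.range T, g t ω ∂P := by
    refine integral_mono_of_nonneg (Eventually.of_forall fun ω => ?_)
      (integrable_finsetSum _ fun t _ => hgi t) (Eventually.of_forall fun ω => ?_)
    · exact Finset.sum_nonneg fun t _ => hΔ0 _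
    · exact Finset.sum_le_sum fun t _ => hpt t ω
  have hgint : ∀ t, ∫ ω, g t ω ∂P =
      ∑ i ∈ Finset.univ.erase opt, (μ opt - μ i) * P.real (W t i) + D * P.real (E t) := by
    intro t
    simp only [hg]
    rw [integral_add (integrable_finsetSum _ fun i _ => (hind (hWm t i)).const_mul _)
      ((hind (hEm t)).const_mul _), integral_finsetSum _ fun i _ => (hind (hWm t i)).const_mul _,
      integral_const_mul, integral_indicator_one (hEm t)]
    congr 1
    refine Finset.sum_congr rfl fun i _ => ?_
    rw [integral_const_mul, integral_indicator_one (hWm t i)]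
  rw [integral_finsetSum _ fun t _ => hgi t, Finset.sum_congr rfl fun t _ => hgint t,
    Finset.sum_add_distrib, Finset.sum_comm, ← Finset.mul_sum] at hle
  simp_rw [← Finset.mul_sum] at hle
  refine hle.trans (add_le_add (Finset.sum_le_sum fun i hi => ?_) ?_)
  · refine mul_le_mul_of_nonneg_left ?_ (hΔ0 i)
    have hi' := hΔ i (Finset.ne_of_mem_erase hi)
    have hb := h.sum_measure_suboptimal_le (hσ i) hε hi' T
    rw [add_sub_cancel] at hb
    have hpos : 0 ≤ Real.log T / Real.log (1 + (2 * (μ opt - μ i) - 4 * ε) / σ i) +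
        2 * σ i / ε + 1 / σ i + max (7 / 2) (9 / 2 - (⌈k⌉ : ℝ)) := by
      have h1 : 0 ≤ (2 * (μ opt - μ i) - 4 * ε) / σ i := div_nonneg (by linarith) (hσ i).le
      have h2 : 0 ≤ Real.log T := Real.log_natCast_nonneg T
      have h3 : 0 ≤ Real.log (1 + (2 * (μ opt - μ i) - 4 * ε) / σ i) :=
        Real.log_nonneg (by linarith)
      have h4 : (0 : ℝ) ≤ max (7 / 2) (9 / 2 - (⌈k⌉ : ℝ)) := le_max_of_le_left (by norm_num)
      have := hσ i
      positivity
    have hr := ENNReal.toReal_le_of_le_ofReal hpos hb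
    rwa [ENNReal.toReal_sum fun t _ => measure_ne_top _ _] at hr
  · refine mul_le_mul_of_nonneg_left ?_ hD0
    have hb := h.sum_measure_optimal_le (hσ opt) hε T
    have hEq : ∑ t ∈ Finset.range T, P (E t) =
        ∑ t ∈ Finset.Ico (K * n0 k) T, P {ω | ∀ i, (θ t i ω).2 < y} := by
      rw [← Finset.sum_subset (s₁ := Finset.Ico (K * n0 k) T)]
      · refine Finset.sum_congr rfl fun t ht => ?_
        congr 1
        ext ω
        simp only [hE, mem_ofPred_eq, (Finset.mem_Ico.1 ht).1, true_and]
      · exact fun t ht => Finset.mem_range.2 (Finset.mem_Ico.1 ht).2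
      · intro t ht ht'
        have : E t = ∅ := by
          ext ω
          simp only [hE, mem_ofPred_eq, mem_empty_iff_false, iff_false, not_and]
          intro hc
          exact absurd (Finset.mem_Ico.2 ⟨hc, Finset.mem_range.1 ht⟩) ht'
        rw [this, measure_empty]
    rw [← hEq] at hb
    have hr := ENNReal.toReal_le_of_le_ofReal (optConst_nonneg hε (hσ opt)) hb
    rwa [ENNReal.toReal_sum fun t _ => measure_ne_top _ _] at hr

/-- With `ε` fixed, the finite-time bound is `A * log T + B` with `B` independent of `T`. -/
lemma limsup_regret_le [IsProbabilityMeasure P] (h : IsTSTRun P μ σ k X θ arm)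
    {opt : Fin K} (hσ : ∀ i, 0 < σ i) (hopt : ∀ i, i ≠ opt → μ i < μ opt) {ε : ℝ} (hε : 0 < ε)
    (hΔ : ∀ i, i ≠ opt → ε < (μ opt - μ i) / 2) :
    limsup (fun T : ℕ => (((∫ ω, regret μ opt arm T ω ∂P) / Real.log T : ℝ) : EReal)) atTop ≤
      ((∑ i ∈ Finset.univ.erase opt,
        (μ opt - μ i) / Real.log (1 + (2 * (μ opt - μ i) - 4 * ε) / σ i) : ℝ) : EReal) := by
  set A := ∑ i ∈ Finset.univ.erase opt,
    (μ opt - μ i) / Real.log (1 + (2 * (μ opt - μ i) - 4 * ε) / σ i) with hA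
  obtain ⟨B, hB⟩ : ∃ B : ℝ, ∀ T : ℕ, ∫ ω, regret μ opt arm T ω ∂P ≤ A * Real.log T + B := by
    refine ⟨∑ i ∈ Finset.univ.erase opt, (μ opt - μ i) *
        (2 * σ i / ε + 1 / σ i + max (7 / 2) (9 / 2 - (⌈k⌉ : ℝ))) +
      Finset.univ.sup' ⟨opt, Finset.mem_univ opt⟩ (fun i => μ opt - μ i) *
        optConst ε k (σ opt), fun T => (h.integral_regret_le hσ hopt hε hΔ T).trans_eq ?_⟩
    rw [hA, Finset.sum_mul, ← add_assoc, ← Finset.sum_add_distrib]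
    congr 1
    exact Finset.sum_congr rfl fun i _ => by ring
  have hlog : Tendsto (fun T : ℕ => Real.log T) atTop atTop :=
    Real.tendsto_log_atTop.comp tendsto_natCast_atTop_atTop
  have hlim : Tendsto (fun T : ℕ => ((A + B / Real.log T : ℝ) : EReal)) atTop (𝓝 (A : EReal)) := by
    refine (continuous_coe_real_ereal.tendsto A).comp ?_
    simpa using (tendsto_const_nhds (x := A)).add (hlog.const_div_atTop B)
  rw [← hlim.limsup_eq]
  refine limsup_le_limsup ?_
  filter_upwards [hlog.eventually_gt_atTop 0] with T hT
  rw [EReal.coe_le_coe_iff, div_le_iff₀ hT, add_mul, div_mul_cancel₀ _ hT.ne']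
  exact hB T

lemma asymptoticallyOptimal [IsProbabilityMeasure P] (h : IsTSTRun P μ σ k X θ arm)
    {opt : Fin K} (hσ : ∀ i, 0 < σ i) (hopt : ∀ i, i ≠ opt → μ i < μ opt) :
    AsymptoticallyOptimal P μ σ opt arm := by
  rw [AsymptoticallyOptimal]
  have hkl : ∑ i ∈ Finset.univ.erase opt, (μ opt - μ i) / (klInf (μ i) (σ i) (μ opt)).toReal =
      ∑ i ∈ Finset.univ.erase opt,
        (μ opt - μ i) / Real.log (1 + (2 * (μ opt - μ i) - 4 * 0) / σ i) := by
    refine Finset.sum_congr rfl fun i hi => ?_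
    have hi' := hopt i (Finset.ne_of_mem_erase hi)
    have hpos : 0 ≤ 2 * (μ opt - μ i) / σ i := div_nonneg (by linarith) (hσ i).le
    rw [klInf_eq (hσ i) hi', ENNReal.toReal_ofReal (Real.log_nonneg (by linarith)), mul_zero,
      sub_zero]
  rw [hkl]
  have hev : ∀ᶠ ε : ℝ in 𝓝[>] 0, 0 < ε ∧ ∀ i, i ≠ opt → ε < (μ opt - μ i) / 2 := by
    refine (eventually_mem_nhdsWithin).and (eventually_all.2 fun i => ?_)
    by_cases hi : i = opt
    · exact Eventually.of_forall fun ε hne => absurd hi hne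
    · have h0 : 0 < (μ opt - μ i) / 2 := by linarith [hopt i hi]
      filter_upwards [mem_nhdsWithin_of_mem_nhds (Iio_mem_nhds h0)] with ε hε _
      exact hε
  refine ge_of_tendsto (x := 𝓝[>] (0 : ℝ)) ?_
    (hev.mono fun ε hε => h.limsup_regret_le hσ hopt hε.1 hε.2)
  refine (continuous_coe_real_ereal.tendsto _).comp ?_
  refine tendsto_finsetSum _ fun i hi => ?_
  have hi' := hopt i (Finset.ne_of_mem_erase hi)
  have hpos : 0 < (2 * (μ opt - μ i) - 4 * 0) / σ i := div_pos (by linarith) (hσ i)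
  have hc : ContinuousAt (fun ε : ℝ =>
      (μ opt - μ i) / Real.log (1 + (2 * (μ opt - μ i) - 4 * ε) / σ i)) 0 := by
    refine continuousAt_const.div (ContinuousAt.log ?_ (by positivity))
      (Real.log_pos (by linarith)).ne'
    fun_prop
  exact hc.tendsto.mono_left nhdsWithin_le_nhds

end IsTSTRun

end RegretBound

end UniformBandit

theorem theorem4 :
    ∃ C' : ℝ → ℝ → ℝ → ℝ,
      -- `C' ε k σ₁` is explicit for `k < 1`
      (∀ ε k σ₁ : ℝ, 0 < ε → 0 < σ₁ → k < 1 →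
        C' ε k σ₁ = 1 + 9 * σ₁ / ε + 3 / 16 * max 1 (1 / (1 - k)) * (σ₁ ^ 2 / ε ^ 2) *
          (2 * Real.exp (2 * ε / σ₁) - 1)) ∧
      (∀ k : ℝ, k < 1 → ∀ ε₀ σ₀ : ℝ, 0 < ε₀ → 0 < σ₀ →
        (fun p : ℝ × ℝ => C' p.1 k p.2) =O[𝓟 (Set.Ioc 0 ε₀ ×ˢ Set.Ici σ₀)]
          (fun p : ℝ × ℝ => p.2 ^ 2 / p.1 ^ 2)) ∧
      -- growth for `k = 1`
      (∀ ε₁ ε₀ σ₀ : ℝ, 0 < ε₁ → 1 < σ₀ →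
        (fun p : ℝ × ℝ => C' p.1 1 p.2) =O[𝓟 (Set.Icc ε₁ ε₀ ×ˢ Set.Ici σ₀)]
          (fun p : ℝ × ℝ => p.2 ^ 2 * Real.log p.2 / p.1 ^ 2)) ∧
      (∀ ε₀ σ₀ : ℝ, 0 < ε₀ → 0 < σ₀ →
        (fun p : ℝ × ℝ => C' p.1 1 p.2) =O[𝓟 (Set.Ioc 0 ε₀ ×ˢ Set.Ici σ₀)]
          (fun p : ℝ × ℝ => p.2 ^ 2 * Real.log (1 + p.2 / p.1) / p.1 ^ 2)) ∧
      -- growth for `k > 1`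
      (∀ k : ℝ, 1 < k → ∀ ε₀ σ₀ : ℝ, 0 < ε₀ → 0 < σ₀ →
        (fun p : ℝ × ℝ => C' p.1 k p.2) =O[𝓟 (Set.Ioc 0 ε₀ ×ˢ Set.Ici σ₀)]
          (fun p : ℝ × ℝ => p.2 ^ (2 * k) / p.1 ^ (k + 1))) ∧
      -- finite-time regret bound and asymptotic optimality, for every real `k`
      ∀ (k : ℝ) (K : ℕ) (μ σ : Fin K → ℝ) (opt : Fin K),
        (∀ i, 0 < σ i) → (∀ i, i ≠ opt → μ i < μ opt) →
        ∀ (Ω : Type*) [MeasurableSpace Ω] (P : Measure Ω) [IsProbabilityMeasure P]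
          (X : Fin K → ℕ → Ω → ℝ) (θ : ℕ → Fin K → Ω → ℝ × ℝ) (arm : ℕ → Ω → Fin K),
          UniformBandit.IsTSTRun P μ σ k X θ arm →
          (∀ ε : ℝ, 0 < ε → (∀ i, i ≠ opt → ε < (μ opt - μ i) / 2) → ∀ T : ℕ,
            ∫ ω, UniformBandit.regret μ opt arm T ω ∂P ≤
              ∑ i ∈ Finset.univ.erase opt, (μ opt - μ i) *
                (Real.log T / Real.log (1 + (2 * (μ opt - μ i) - 4 * ε) / σ i) + 2 * σ i / ε +
                  1 / σ i + max (7 / 2) (9 / 2 - (⌈k⌉ : ℝ))) +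
              Finset.univ.sup' ⟨opt, Finset.mem_univ opt⟩ (fun i => μ opt - μ i) *
                C' ε k (σ opt)) ∧
          UniformBandit.AsymptoticallyOptimal P μ σ opt arm := by
  refine ⟨UniformBandit.optConst, fun ε k σ₁ _ _ hk => ?_, fun k hk ε₀ σ₀ _ hσ₀ => ?_,
    fun ε₁ ε₀ σ₀ hε₁ hσ₀ => ?_, fun ε₀ σ₀ hε₀ hσ₀ => ?_, fun k hk ε₀ σ₀ hε₀ hσ₀ => ?_,
    fun k K μ σ opt hσ hopt Ω _ P _ X θ arm h => ⟨fun ε hε hΔ T => ?_, ?_⟩⟩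
  · rw [UniformBandit.optConst, if_pos hk]
  · exact UniformBandit.isBigO_optConst_of_lt_one hk hσ₀
  · exact UniformBandit.isBigO_optConst_one_of_le hε₁ hσ₀
  · exact UniformBandit.isBigO_optConst_one hε₀ hσ₀
  · exact UniformBandit.isBigO_optConst_of_one_lt hk hε₀ hσ₀
  · exact h.integral_regret_le hσ hopt hε hΔ T
  · exact h.asymptoticallyOptimal hσ hopt
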